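/- **Setting.** A *group pair* consists of pairwise disjoint groups $G_x$ ($x\in I$), an equivalence relation $\mathcal E$ on $I$, and for each $(x,y)\in\mathcal E$ an isomorphism $\varphi_{xy}\colon G_x/H_{xy}\to G_y/K_{xy}$ between quotients by normal subgroups. For a union $D$ of cosets, $\varphi_{xy}[D]$ denotes the union of the images of these cosets. For a coset $\alpha$ of $H_{xy}$ put $R_{xy,\alpha}=\bigcup_\gamma \gamma\times\varphi_{xy}[\gamma\alpha]\subseteq G_x\times G_y$, where $\gamma$ ranges over the cosets of $H_{xy}$. Let $A$ be the set of all unions of relations $R_{xy,\alpha}$, $U=\bigcup_x G_x$ and $E=\bigcup_{(x,y)\in\mathcal E}G_x\times G_y$. The pair is a *group frame* if, for all $(x,y),(y,z)\in\mathcal E$: (i) $\varphi_{xx}$ is the identity of $G_x/\{e_x\}$; (ii) $\varphi_{yx}=\varphi_{xy}^{-1}$; (iii) $\varphi_{xy}[H_{xy}H_{xz}]=K_{xy}H_{yz}$ and $\varphi_{yz}[K_{xy}H_{yz}]=K_{xz}K_{yz}$; (iv) $\varphi_{yz}[\varphi_{xy}[D]]=\varphi_{xz}[D]$ for every coset $D$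 of $H_{xy}H_{xz}$. Then $A$ with union, complement relative to $E$, relational composition, inverse, and $\mathrm{id}_U$ is the *full group relation algebra* on the frame. A *group triple* has in addition cosets $C_{xyz}$ of $H_{xy}H_{xz}$ in $G_x$ for $(x,y),(y,z)\in\mathcal E$. On $A$ define $$R_{xy,\alpha}\otimes R_{yz,\beta}=\bigcup\{R_{xz,\gamma}:\gamma\subseteq\varphi_{xy}^{-1}[\varphi_{xy}(\alpha)\,\beta]\,C_{xyz}\},\qquad R_{xy,\alpha}\otimes R_{wz,\beta}=\varnothing\ (w\ne y),$$ extended distributively to arbitrary unions. The triple is a *semi-frame* if (i), (ii), the first half of (iii), and $\varphi_{yz}[\varphi_{xy}[D]]=\varphi_{xz}[C_{xyz}^{-1}DC_{xyz}]$ hold (for all cosets $D$ of $H_{xy}H_{xz}$). It satisfies the *coset conditions* if $C_{xyy}=H_{xy}$, $\varphi_{xz}[C_{xyz}]=C_{zyx}^{-1}$, $\varphi_{xy}[C_{xyz}]=C_{yxz}^{-1}$ and $C_{xyz}C_{xzw}=\varphi_{yx}[C_{yzw}H_{yx}]\,C_{xyw}$ (for all $(x,y),(y,z),(z,w)\in\mathcal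 E$). In that case the algebra $\mathfrak C[\mathcal F]$ with universe $A$ and operations union, complement relative to $E$, $\otimes$, inverse, and $\mathrm{id}_U$ is called the *full coset relation algebra* on the triple. A relation algebra is *measurable* if its identity element $1'$ is a sum of measurable atoms, where an atom $x\le 1'$ is measurable if $x;1;x$ is a sum of elements $f$ with $f^{\smile};f\le 1'$. An algebra is *representable* if it is isomorphic to a subalgebra of the algebra of all subrelations of some equivalence relation $E'$ on some set $V$, with union, complement relative to $E'$, relational composition, inverse, and $\mathrm{id}_V$. **The example.** Let $I=\{p,q,r,s,t\}$, let $\mathcal E=I\times I$, and let the $G_x$ be disjoint copies of $\mathbb Z_2^3$. Let $L_0,L_1,L_2,L_3$ be the subgroups of order two of $\mathbb Z_2^3$ generated by $(1,0,0)$, $(0,1,0)$, $(0,0,1)$, $(1,1,1)$. Fix, at each vertex $x$ of the complete graph on $I$, a numbering $y\mapsto\ell_x(y)$ of the four edges from $x$ to the other vertices $y$ by the distinct numbers $0,1,2,3$. For $x\neq y$ let $H_{xy}=L_{\ell_x(y)}$ in $G_x$, let $H_{xx}$ be trivial, and let $K_{xy}=H_{yx}$. Let $\varphi_{xy}\colon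 G_x/H_{xy}\to G_y/H_{yx}$ be induced by the automorphism of $\mathbb Z_2^3$ that maps the generator of $L_{\ell_x(y)}$ to that of $L_{\ell_y(x)}$, and the generator of $L_{\ell_x(z)}$ to that of $L_{\ell_y(z)}$ for all $z\ne x,y$; let $\varphi_{xx}$ be the identity. Put $C_{xyz}=G_x\setminus H_{xy}H_{xz}$ if $(x,y,z)$ is a permutation of $(p,q,r)$, and $C_{xyz}=H_{xy}H_{xz}$ otherwise. Let $\bar{\mathcal F}=(G,\varphi,C)$. **Theorem.** For every such numbering, the maps $\varphi_{xy}$ are the unique isomorphisms $G_x/H_{xy}\to G_y/H_{yx}$ that make $(G,\varphi)$ a group frame. The group triple $\bar{\mathcal F}$ is a semi-frame that satisfies the coset conditions, and the full coset relation algebra $\mathfrak C[\bar{\mathcal F}]$ is a finite, measurable relation algebra. It is not representable as a set relation algebra; in particular, it is neither isomorphic to, nor embeddable into, any full group relation algebra. -/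

import Mathlib

open scoped Pointwise

universe u v w

namespace CosetRA

/-! ### Abstract relation algebras -/

/-- An algebra `(A, +, -, ;, ˘, 1')` of the similarity type of relation algebras. -/
structure RelAlg where
  carrier : Type u
  add : carrier → carrier → carrier
  neg : carrier → carrier
  comp : carrier → carrier → carrier
  conv : carrier → carrier
  ident : carrier

namespace RelAlg

variable (A : RelAlg.{u})

/-- The Boolean order: `a ≤ b` iff `a + b = b`. -/
def le (a b : A.carrier) : Prop := A.add a b = b

/-- The unit `1 = 1' + -1'`. -/
def one : A.carrier := A.add A.ident (A.neg A.ident)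

/-- The zero element `0 = -1`. -/
def zero : A.carrier := A.neg A.one

/-- The Boolean product `a · b = -(-a + -b)`. -/
def inf (a b : A.carrier) : A.carrier := A.neg (A.add (A.neg a) (A.neg b))

/-- The axioms (R1)-(R9) of relation algebras, with Tarski's tenth axiom replaced by the (on the
basis of the others) equivalent cycle law. -/
structure IsRelationAlgebra : Prop where
  add_comm : ∀ r s, A.add r s = A.add s r
  add_assoc : ∀ r s t, A.add r (A.add s t) = A.add (A.add r s) t
  huntington : ∀ r s,
    A.add (A.neg (A.add (A.neg r) s)) (A.neg (A.add (A.neg r) (A.neg s))) = r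
  comp_assoc : ∀ r s t, A.comp r (A.comp s t) = A.comp (A.comp r s) t
  comp_ident : ∀ r, A.comp r A.ident = r
  conv_conv : ∀ r, A.conv (A.conv r) = r
  conv_comp : ∀ r s, A.conv (A.comp r s) = A.comp (A.conv s) (A.conv r)
  add_comp : ∀ r s t, A.comp (A.add r s) t = A.add (A.comp r t) (A.comp s t)
  conv_add : ∀ r s, A.conv (A.add r s) = A.add (A.conv r) (A.conv s)
  cycle : ∀ r s t, A.inf (A.comp r s) t = A.zero → A.inf (A.comp (A.conv r) t) s = A.zero

/-- `a` is the sum (least upper bound) of the set `S`. -/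
def IsSum (S : Set A.carrier) (a : A.carrier) : Prop :=
  (∀ s ∈ S, A.le s a) ∧ ∀ b, (∀ s ∈ S, A.le s b) → A.le a b

/-- `a` is an atom. -/
def IsAtomElt (a : A.carrier) : Prop :=
  a ≠ A.zero ∧ ∀ b, A.le b a → b = A.zero ∨ b = a

/-- `f` is a functional element: `f˘ ; f ≤ 1'`. -/
def IsFunctional (f : A.carrier) : Prop := A.le (A.comp (A.conv f) f) A.ident

/-- A measurable element: a subidentity atom `x` whose square `x;1;x` is a sum of functional
elements. -/
def IsMeasurableElt (x : A.carrier) : Prop :=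
  A.le x A.ident ∧ A.IsAtomElt x ∧
    ∃ S : Set A.carrier, (∀ f ∈ S, A.IsFunctional f) ∧
      A.IsSum S (A.comp (A.comp x A.one) x)

/-- The algebra is measurable: the identity element is a sum of measurable atoms. -/
def IsMeasurable : Prop :=
  ∃ S : Set A.carrier, (∀ x ∈ S, A.IsMeasurableElt x) ∧ A.IsSum S A.ident

variable {A} in
/-- `f` is a homomorphism. -/
structure IsHom {B : RelAlg.{v}} (f : A.carrier → B.carrier) : Prop where
  map_add : ∀ a b, f (A.add a b) = B.add (f a) (f b)
  map_neg : ∀ a, f (A.neg a) = B.neg (f a)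
  map_comp : ∀ a b, f (A.comp a b) = B.comp (f a) (f b)
  map_conv : ∀ a, f (A.conv a) = B.conv (f a)
  map_ident : f A.ident = B.ident

/-- `A` is isomorphic to `B`. -/
def Isomorphic (B : RelAlg.{v}) : Prop :=
  ∃ f : A.carrier → B.carrier, IsHom f ∧ Function.Bijective f

/-- `A` is embeddable into `B`, that is, isomorphic to a subalgebra of `B`. -/
def Embeddable (B : RelAlg.{v}) : Prop :=
  ∃ f : A.carrier → B.carrier, IsHom f ∧ Function.Injective f

/-- The full set relation algebra on an equivalence relation `E` on a base set `V`: all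
subrelations of `E`, with union, complement relative to `E`, relational composition, relational
inverse, and the identity relation on `V`. -/
def fullSet {V : Type w} (E : Setoid V) : RelAlg.{w} where
  carrier := {X : SetRel V V // ∀ p ∈ X, E.r p.1 p.2}
  add X Y := ⟨X.1 ∪ Y.1, fun p hp => hp.elim (X.2 p) (Y.2 p)⟩
  neg X := ⟨{p | E.r p.1 p.2} \ X.1, fun _ hp => hp.1⟩
  comp X Y := ⟨SetRel.comp X.1 Y.1, by
    rintro ⟨a, c⟩ ⟨b, h1, h2⟩
    exact E.trans' (y := b) (X.2 (a, b) h1) (Y.2 (b, c) h2)⟩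
  conv X := ⟨SetRel.inv X.1, fun _ hp => E.symm' (X.2 _ hp)⟩
  ident := ⟨SetRel.id, fun p (hp : p.1 = p.2) => hp ▸ E.refl' p.1⟩

/-- `A` is representable: it is isomorphic to a set relation algebra, that is, to a subalgebra of
the full set relation algebra on some equivalence relation (on a set in the universe `w`). -/
def Representable : Prop :=
  ∃ (V : Type w) (E : Setoid V), A.Embeddable (fullSet E)

end RelAlg

/-! ### Group pairs and group relation algebras -/

/-- A group pair: a system of groups `G x` (their disjoint union is the sigma type), an equivalence
relation `E` on the index set, and, for each pair `(x, y)` in `E`, an isomorphism `φ` from a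
quotient `G x ⧸ H x y` to a quotient `G y ⧸ K x y`. The values of `H` and `K` at pairs outside `E`
play no role. -/
structure GroupPair {I : Type u} (G : I → Type v) [∀ x, Group (G x)] where
  E : Setoid I
  H : ∀ x : I, I → Subgroup (G x)
  K : ∀ _ y : I, Subgroup (G y)
  normalH : ∀ x y, (H x y).Normal
  normalK : ∀ x y, (K x y).Normal
  φ : ∀ {x y}, E.r x y → (G x ⧸ H x y ≃* G y ⧸ K x y)

attribute [instance] GroupPair.normalH GroupPair.normalK

namespace GroupPair

variable {I : Type u} {G : I → Type v} [∀ x, Group (G x)] (F : GroupPair G)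

/-- The image `φ_xy[D]` of a union `D` of cosets of `H x y`, again as a set of group elements. -/
def img {x y : I} (h : F.E.r x y) (D : Set (G x)) : Set (G y) :=
  {b | ∃ a ∈ D, F.φ h (a : G x ⧸ F.H x y) = (b : G y ⧸ F.K x y)}

/-- The inverse image `φ_xy⁻¹[D]` of a union `D` of cosets of `K x y`, as a set of group
elements. -/
def preimg {x y : I} (h : F.E.r x y) (D : Set (G y)) : Set (G x) :=
  {a | ∃ b ∈ D, F.φ h (a : G x ⧸ F.H x y) = (b : G y ⧸ F.K x y)}

/-- An element of the quotient `G x ⧸ H x y`, as a coset, i.e. as a set of group elements. -/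
def cosetH {x y : I} (α : G x ⧸ F.H x y) : Set (G x) := {a | (a : G x ⧸ F.H x y) = α}

/-- An element of the quotient `G y ⧸ K x y`, as a coset, i.e. as a set of group elements. -/
def cosetK {x y : I} (α : G y ⧸ F.K x y) : Set (G y) := {b | (b : G y ⧸ F.K x y) = α}

/-- The unit `E = ⋃ {G x × G y : (x, y) ∈ E}`, as a relation on `U = ⋃ G x`. -/
def unit : SetRel (Σ x, G x) (Σ x, G x) := {p | F.E.r p.1.1 p.2.1}

/-- The relation `R_{xy,α}`, the union over all cosets `γ` of `H x y` of the sets `γ × φ_xy[γ ∘ α]`: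
it consists of the pairs `(a, b)` in `G x × G y` such that `φ_xy` maps the coset of `a` times `α`
to the coset of `b`. Here `α` is the coset itself in place of its index. -/
def atom {x y : I} (h : F.E.r x y) (α : G x ⧸ F.H x y) : SetRel (Σ x, G x) (Σ x, G x) :=
  {p | ∃ (a : G x) (b : G y), p = (⟨x, a⟩, ⟨y, b⟩) ∧
    F.φ h ((a : G x ⧸ F.H x y) * α) = (b : G y ⧸ F.K x y)}

/-- The set of all relations `R_{xy,α}`. -/
def atoms : Set (SetRel (Σ x, G x) (Σ x, G x)) :=
  {R | ∃ (x y : I) (h : F.E.r x y) (α : G x ⧸ F.H x y), R = F.atom h α}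

/-- The set of frame relations: all unions of sets of relations `R_{xy,α}`. -/
def relations : Set (SetRel (Σ x, G x) (Σ x, G x)) := {X | ∃ S ⊆ F.atoms, X = ⋃₀ S}

/-- The first three of the semi-frame conditions. In (i), the requirement that `φ_xx` is the
identity automorphism of `G x ⧸ {e}` is expressed through the graph of `φ_xx`, lifted to elements:
it says that `H x x` and `K x x` are trivial and that `φ_xx` is the identity. Likewise, (ii) says
that `H y x = K x y`, `K y x = H x y`, and that `φ_yx` is the inverse of `φ_xy`. -/
structure PreFrame : Prop where
  refl : ∀ x (a b : G x), F.φ (F.E.refl' x) (a : G x ⧸ F.H x x) = (b : G x ⧸ F.K x x) ↔ a = b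
  symm : ∀ {x y} (h : F.E.r x y) (a : G x) (b : G y),
    F.φ (F.E.symm' h) (b : G y ⧸ F.H y x) = (a : G x ⧸ F.K y x) ↔
      F.φ h (a : G x ⧸ F.H x y) = (b : G y ⧸ F.K x y)
  img_mul : ∀ {x y z} (h : F.E.r x y) (_ : F.E.r y z),
    F.img h ((F.H x y : Set (G x)) * F.H x z) = (F.K x y : Set (G y)) * F.H y z

/-- The frame conditions. In (iv), `D` ranges over the cosets of `H x y ∘ H x z`, and the induced
isomorphisms map such cosets (as sets) to their images. -/
structure IsGroupFrame : Prop extends F.PreFrame where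
  img_mul' : ∀ {x y z} (_ : F.E.r x y) (h : F.E.r y z),
    F.img h ((F.K x y : Set (G y)) * F.H y z) = (F.K x z : Set (G z)) * F.K y z
  img_img : ∀ {x y z} (h : F.E.r x y) (h' : F.E.r y z) (g : G x) (D : Set (G x)),
    D = {g} * ((F.H x y : Set (G x)) * F.H x z) →
      F.img h' (F.img h D) = F.img (F.E.trans' h h') D

section closure

variable {F}

theorem exists_atom {p : (Σ x, G x) × (Σ x, G x)} (h : p ∈ F.unit) :
    ∃ α, p ∈ F.atom (x := p.1.1) (y := p.2.1) h α :=
  ⟨((p.1.2 : G p.1.1) : G p.1.1 ⧸ F.H _ _)⁻¹ * (F.φ h).symm (p.2.2 : G p.2.1), p.1.2, p.2.2, rfl,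
    by simp⟩

theorem atom_subset_unit {x y : I} (h : F.E.r x y) (α : G x ⧸ F.H x y) :
    F.atom h α ⊆ F.unit := by
  rintro _ ⟨a, b, rfl, -⟩
  exact h

theorem atom_unique {R S : SetRel (Σ x, G x) (Σ x, G x)} (hR : R ∈ F.atoms) (hS : S ∈ F.atoms)
    {p} (h1 : p ∈ R) (h2 : p ∈ S) : R = S := by
  obtain ⟨x, y, h, α, rfl⟩ := hR
  obtain ⟨x', y', h', β, rfl⟩ := hS
  obtain ⟨a, b, rfl, e⟩ := h1
  obtain ⟨a', b', e1, e'⟩ := h2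
  simp only [Prod.mk.injEq, Sigma.mk.injEq] at e1
  obtain ⟨⟨rfl, ha⟩, rfl, hb⟩ := e1
  obtain rfl := eq_of_heq ha
  obtain rfl := eq_of_heq hb
  have := (F.φ h).injective (e.trans e'.symm)
  rw [mul_left_cancel this]

theorem mem_relations_iff {X : SetRel (Σ x, G x) (Σ x, G x)} :
    X ∈ F.relations ↔ X ⊆ F.unit ∧ ∀ R ∈ F.atoms, ∀ p ∈ R, p ∈ X → R ⊆ X := by
  constructor
  · rintro ⟨S, hS, rfl⟩
    refine ⟨?_, ?_⟩
    · rintro p ⟨R, hR, hp⟩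
      obtain ⟨x, y, h, α, rfl⟩ := hS hR
      exact atom_subset_unit h α hp
    · rintro R hR p hp ⟨R', hR', hp'⟩
      rw [atom_unique hR (hS hR') hp hp']
      exact Set.subset_sUnion_of_mem hR'
  · rintro ⟨h1, h2⟩
    refine ⟨{R | R ∈ F.atoms ∧ R ⊆ X}, fun R hR => hR.1, ?_⟩
    ext p
    constructor
    · intro hp
      obtain ⟨α, hα⟩ := exists_atom (h1 hp)
      exact ⟨_, ⟨⟨_, _, _, _, rfl⟩, h2 _ ⟨_, _, _, _, rfl⟩ p hα hp⟩, hα⟩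
    · rintro ⟨R, hR, hp⟩
      exact hR.2 hp

theorem union_mem {X Y : SetRel (Σ x, G x) (Σ x, G x)} (hX : X ∈ F.relations)
    (hY : Y ∈ F.relations) : X ∪ Y ∈ F.relations := by
  rw [mem_relations_iff] at *
  refine ⟨Set.union_subset hX.1 hY.1, ?_⟩
  rintro R hR p hp (h | h)
  · exact (hX.2 R hR p hp h).trans Set.subset_union_left
  · exact (hY.2 R hR p hp h).trans Set.subset_union_right

theorem compl_mem {X : SetRel (Σ x, G x) (Σ x, G x)} (hX : X ∈ F.relations) :
    F.unit \ X ∈ F.relations := by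
  rw [mem_relations_iff] at *
  refine ⟨Set.sdiff_subset, ?_⟩
  rintro R hR p hp ⟨-, h⟩ q hq
  refine ⟨?_, fun hqX => h (hX.2 R hR q hq hqX hp)⟩
  obtain ⟨x, y, h', α, rfl⟩ := hR
  exact atom_subset_unit h' α hq

theorem inv_mem (hF : F.PreFrame) {X : SetRel (Σ x, G x) (Σ x, G x)} (hX : X ∈ F.relations) :
    SetRel.inv X ∈ F.relations := by
  rw [mem_relations_iff] at *
  refine ⟨fun p hp => F.E.symm' (hX.1 hp), ?_⟩
  rintro R ⟨x, y, h, α, rfl⟩ _ ⟨a, b, rfl, e⟩ hp _ ⟨a', b', rfl, e'⟩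
  obtain ⟨c, rfl⟩ := QuotientGroup.mk_surjective α
  rw [← QuotientGroup.mk_mul, ← hF.symm h] at e e'
  refine hX.2 (F.atom (F.E.symm' h)
    ((F.φ (F.E.symm' h)).symm ((c : G x ⧸ F.K y x)⁻¹))) ⟨_, _, _, _, rfl⟩ (⟨y, b⟩, ⟨x, a⟩)
    ⟨b, a, rfl, ?_⟩ hp ⟨b', a', rfl, ?_⟩
  · rw [map_mul, e]; simp
  · rw [map_mul, e']; simp

theorem id_mem (hF : F.PreFrame) : SetRel.id ∈ F.relations := by
  rw [mem_relations_iff]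
  refine ⟨fun p (hp : p.1 = p.2) => ?_, ?_⟩
  · change F.E.r p.1.1 p.2.1
    rw [hp]
  rintro R ⟨x, y, h, α, rfl⟩ _ ⟨a, b, rfl, e⟩ hp _ ⟨a', b', rfl, e'⟩
  obtain ⟨c, rfl⟩ := QuotientGroup.mk_surjective α
  have hp' : (⟨x, a⟩ : Σ x, G x) = ⟨y, b⟩ := hp
  simp only [Sigma.mk.injEq] at hp'
  obtain ⟨rfl, hab⟩ := hp'
  obtain rfl := eq_of_heq hab
  rw [← QuotientGroup.mk_mul] at e e'
  have h1 := (hF.refl x _ _).1 e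
  have h2 := (hF.refl x _ _).1 e'
  have hc : c = 1 := by simpa using h1
  subst hc
  have h3 : a' = b' := by simpa using h2
  subst h3
  rfl

theorem comp_mem (hF : F.IsGroupFrame) {X Y : SetRel (Σ x, G x) (Σ x, G x)}
    (hX : X ∈ F.relations) (hY : Y ∈ F.relations) : SetRel.comp X Y ∈ F.relations := by
  rw [mem_relations_iff] at *
  refine ⟨?_, ?_⟩
  · rintro ⟨p1, p2⟩ ⟨q, h1, h2⟩
    exact F.E.trans' (y := q.1) (hX.1 h1) (hY.1 h2)
  rintro R ⟨x, z, hxz, γ, rfl⟩ _ ⟨a, c, rfl, e⟩ ⟨⟨y, b⟩, h1, h2⟩ _ ⟨a', c', rfl, e'⟩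
  have hxy : F.E.r x y := hX.1 h1
  have hyz : F.E.r y z := hY.1 h2
  obtain ⟨α, hα⟩ := exists_atom (hX.1 h1)
  obtain ⟨β, hβ⟩ := exists_atom (hY.1 h2)
  have hα' := hX.2 _ ⟨_, _, _, _, rfl⟩ _ hα h1
  have hβ' := hY.2 _ ⟨_, _, _, _, rfl⟩ _ hβ h2
  dsimp only at α β hα hβ hα' hβ'
  obtain ⟨a1, b1, e1, hab⟩ := hα
  obtain ⟨b2, c1, e2, hbc⟩ := hβ
  simp only [Prod.mk.injEq, Sigma.mk.injEq, heq_eq_eq, true_and] at e1 e2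
  obtain ⟨rfl, rfl⟩ := e1
  obtain ⟨rfl, rfl⟩ := e2
  obtain ⟨u, rfl⟩ := QuotientGroup.mk_surjective α
  obtain ⟨w, rfl⟩ := QuotientGroup.mk_surjective β
  obtain ⟨k, rfl⟩ := QuotientGroup.mk_surjective γ
  obtain ⟨w', hw'⟩ := QuotientGroup.mk_surjective ((F.φ hxy).symm (w : G y ⧸ F.K x y))
  have hw : F.φ hxy (w' : G x ⧸ F.H x y) = (w : G y ⧸ F.K x y) := by rw [hw']; simp
  rw [← QuotientGroup.mk_mul] at e e' hab hbc
  -- the pair `(a, c)` lies in the image of the coset of `a u w'`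
  have hc : c ∈ F.img (F.E.trans' hxy hyz)
      ({a * u * w'} * ((F.H x y : Set (G x)) * F.H x z)) := by
    rw [← hF.img_img hxy hyz (a * u * w') _ rfl]
    refine ⟨b * w, ⟨a * u * w', ⟨_, rfl, 1, ⟨1, one_mem _, 1, one_mem _, by simp⟩, by simp⟩, ?_⟩,
      hbc⟩
    rw [QuotientGroup.mk_mul, map_mul, hab, hw, QuotientGroup.mk_mul]
  obtain ⟨d, ⟨_, rfl, _, ⟨m, hm, n, hn, rfl⟩, rfl⟩, hd⟩ := hc
  have hk := (F.φ (F.E.trans' hxy hyz)).injective (hd.trans e.symm)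
  rw [QuotientGroup.eq] at hk
  -- hence the same holds for `(a', c')`
  have hc' : c' ∈ F.img (F.E.trans' hxy hyz)
      ({a' * u * w'} * ((F.H x y : Set (G x)) * F.H x z)) := by
    refine ⟨a' * k, ⟨_, rfl, _, ⟨m, hm, n * ((a * u * w' * (m * n))⁻¹ * (a * k)),
      mul_mem hn hk, rfl⟩, ?_⟩, e'⟩
    simp only
    group
  rw [← hF.img_img hxy hyz (a' * u * w') _ rfl] at hc'
  obtain ⟨b'', ⟨d', ⟨_, rfl, mn, hmn, rfl⟩, hd'⟩, hb''⟩ := hc'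
  obtain ⟨f, hf⟩ := QuotientGroup.mk_surjective (F.φ hxy (mn : G x ⧸ F.H x y))
  have hf' : f ∈ F.img hxy ((F.H x y : Set (G x)) * F.H x z) := ⟨mn, hmn, hf.symm⟩
  rw [hF.img_mul hxy hyz] at hf'
  obtain ⟨k1, hk1, l1, hl1, rfl⟩ := hf'
  obtain ⟨b0, hb0⟩ := QuotientGroup.mk_surjective (F.φ hxy ((a' * u : G x) : G x ⧸ F.H x y))
  have h3 : ((b0 * w * (k1 * l1) : G y) : G y ⧸ F.K x y) = b'' := by
    rw [← hd']
    simp only [QuotientGroup.mk_mul, map_mul] at hb0 hf hw ⊢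
    rw [hb0, ← hw, hf]
  rw [QuotientGroup.eq] at h3
  have hN := F.normalK x y
  -- the intermediate element for `(a', c')`
  have h4 : w * (k1 * (l1 * ((b0 * w * (k1 * l1))⁻¹ * b'') * l1⁻¹)) * w⁻¹ ∈ F.K x y :=
    hN.conj_mem _ (mul_mem hk1 (hN.conj_mem _ h3 _)) _
  refine ⟨⟨y, b0 * (w * (k1 * (l1 * ((b0 * w * (k1 * l1))⁻¹ * b'') * l1⁻¹)) * w⁻¹)⟩,
    hα' ⟨a', _, rfl, ?_⟩, hβ' ⟨_, c', rfl, ?_⟩⟩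
  · rw [← QuotientGroup.mk_mul, ← hb0, QuotientGroup.eq]
    simpa using h4
  · rw [← QuotientGroup.mk_mul, ← hb'']
    congr 1
    rw [QuotientGroup.eq]
    have : (b0 * (w * (k1 * (l1 * ((b0 * w * (k1 * l1))⁻¹ * b'') * l1⁻¹)) * w⁻¹) * w)⁻¹ * b''
        = l1 := by group
    rw [this]
    exact hl1

end closure

/-- The full group relation algebra on a group frame: the frame relations, with union, complement
relative to the unit, relational composition, relational inverse, and the identity relation. -/
def groupAlgebra (hF : F.IsGroupFrame) : RelAlg.{max u v} where
  carrier := {X : SetRel (Σ x, G x) (Σ x, G x) // X ∈ F.relations}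
  add X Y := ⟨X.1 ∪ Y.1, union_mem X.2 Y.2⟩
  neg X := ⟨F.unit \ X.1, compl_mem X.2⟩
  comp X Y := ⟨SetRel.comp X.1 Y.1, comp_mem hF X.2 Y.2⟩
  conv X := ⟨SetRel.inv X.1, inv_mem hF.toPreFrame X.2⟩
  ident := ⟨SetRel.id, id_mem hF.toPreFrame⟩

end GroupPair

/-! ### Group triples and coset relation algebras -/

/-- A group triple: a group pair together with a coset `C x y z` of `H x y ∘ H x z` in `G x`, for
all `x, y, z` with `(x, y)` and `(y, z)` in `E` (other values of `C` play no role). -/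
structure GroupTriple {I : Type u} (G : I → Type v) [∀ x, Group (G x)] extends GroupPair G where
  C : ∀ x : I, I → I → Set (G x)
  coset : ∀ x y z, E.r x y → E.r y z →
    ∃ g : G x, C x y z = {g} * ((H x y : Set (G x)) * (H x z : Set (G x)))

namespace GroupTriple

variable {I : Type u} {G : I → Type v} [∀ x, Group (G x)] (F : GroupTriple G)

/-- The shifted product `⊗`. On atoms, `R_{xy,α} ⊗ R_{yz,β}` is the union of the `R_{xz,γ}` such
that the coset `γ` is included in `φ_xy⁻¹[φ_xy(α) ∘ β] ∘ C x y z`, the other products of atoms are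
empty, and the operation is extended distributively to arbitrary unions of atoms. -/
def otimes (X Y : SetRel (Σ x, G x) (Σ x, G x)) : SetRel (Σ x, G x) (Σ x, G x) :=
  ⋃₀ {R | ∃ (x y z : I) (h : F.E.r x y) (h' : F.E.r y z)
    (α : G x ⧸ F.H x y) (β : G y ⧸ F.H y z) (γ : G x ⧸ F.H x z),
    F.atom h α ⊆ X ∧ F.atom h' β ⊆ Y ∧
    F.cosetH γ ⊆ F.preimg h (F.cosetK (F.φ h α) * F.cosetH β) * F.C x y z ∧
    R = F.atom (F.E.trans' h h') γ}

theorem otimes_mem (X Y : SetRel (Σ x, G x) (Σ x, G x)) : F.otimes X Y ∈ F.relations := by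
  refine ⟨_, ?_, rfl⟩
  rintro R ⟨x, y, z, h, h', α, β, γ, -, -, -, rfl⟩
  exact ⟨x, z, _, γ, rfl⟩

/-- The semi-frame conditions. In (iv), `D` ranges over the cosets of `H x y ∘ H x z`, and
`C⁻¹ ∘ D ∘ C` is the image of `D` under the inner automorphism determined by `C x y z`. -/
structure IsSemiFrame : Prop extends F.PreFrame where
  img_img : ∀ {x y z} (h : F.E.r x y) (h' : F.E.r y z) (g : G x) (D : Set (G x)),
    D = {g} * ((F.H x y : Set (G x)) * F.H x z) →
      F.img h' (F.img h D) = F.img (F.E.trans' h h') ((F.C x y z)⁻¹ * D * F.C x y z)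

/-- The coset conditions. -/
structure CosetConditions : Prop where
  identity : ∀ x y, F.E.r x y → F.C x y y = F.H x y
  involution : ∀ {x y z} (h : F.E.r x y) (h' : F.E.r y z),
    F.img (F.E.trans' h h') (F.C x y z) = (F.C z y x)⁻¹
  cycle : ∀ {x y z} (h : F.E.r x y) (_ : F.E.r y z),
    F.img h (F.C x y z) = (F.C y x z)⁻¹
  assoc : ∀ {x y z w} (h : F.E.r x y) (_ : F.E.r y z) (_ : F.E.r z w),
    F.C x y z * F.C x z w = F.img (F.E.symm' h) (F.C y z w * F.H y x) * F.C x y w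

/-- The algebra constructed from a group triple satisfying conditions (i)-(iii): the unions of
atoms, with union, complement relative to the unit, the shifted product, relational inverse, and
the identity relation. When the triple is a semi-frame satisfying the coset conditions, it is
called the full coset relation algebra on the triple. -/
def cosetAlgebra (hF : F.PreFrame) : RelAlg.{max u v} where
  carrier := {X : SetRel (Σ x, G x) (Σ x, G x) // X ∈ F.relations}
  add X Y := ⟨X.1 ∪ Y.1, GroupPair.union_mem X.2 Y.2⟩
  neg X := ⟨F.unit \ X.1, GroupPair.compl_mem X.2⟩
  comp X Y := ⟨F.otimes X.1 Y.1, F.otimes_mem X.1 Y.1⟩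
  conv X := ⟨SetRel.inv X.1, GroupPair.inv_mem hF X.2⟩
  ident := ⟨SetRel.id, GroupPair.id_mem hF⟩

end GroupTriple

/-! ### The example: five indices, groups `Z₂ × Z₂ × Z₂`

The indices `p, q, r, s, t` are `0, 1, 2, 3, 4`. -/

/-- The group `Z₂ × Z₂ × Z₂`, written additively. -/
abbrev V : Type := ZMod 2 × ZMod 2 × ZMod 2

/-- The group `Z₂ × Z₂ × Z₂`, written multiplicatively. -/
abbrev Z : Type := Multiplicative V

/-- The non-identity elements of the subgroups `L₀, L₁, L₂, L₃`. -/
def gen : Fin 4 → V := ![(1, 0, 0), (0, 1, 0), (0, 0, 1), (1, 1, 1)]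

/-- The four subgroups `L₀, L₁, L₂, L₃` of order two. -/
def L (i : Fin 4) : Subgroup Z where
  carrier := {1, Multiplicative.ofAdd (gen i)}
  one_mem' := by simp
  mul_mem' := by
    have key : ∀ (i : Fin 4) (a b : V), (a = 0 ∨ a = gen i) → (b = 0 ∨ b = gen i) →
        (a + b = 0 ∨ a + b = gen i) := by
      decide
    exact fun {a b} => key i a b
  inv_mem' := by
    have key : ∀ (i : Fin 4) (a : V), (a = 0 ∨ a = gen i) → (-a = 0 ∨ -a = gen i) := by
      decide
    exact fun {a} => key i a

/-- A labelling of the pentagon: at each vertex `x`, the four edges from `x` to the other vertices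
are numbered by `0, 1, 2, 3`, distinct edges at `x` receiving distinct numbers. -/
abbrev Labelling : Type := ∀ x : Fin 5, {y : Fin 5 // y ≠ x} ≃ Fin 4

variable (lab : Labelling)

/-- The subgroup `H_xy`: trivial if `x = y`, and otherwise the subgroup `L_i` where `i` is the label
at `x` of the edge from `x` to `y`. -/
def sub (x y : Fin 5) : Subgroup Z := if h : y ≠ x then L (lab x ⟨y, h⟩) else ⊥

/-- The permutation of the labels which maps the label at `x` of the edge to `y` to the label at
`y` of the edge to `x`, and, for every third vertex `z`, the label at `x` of the edge to `z` to the
label at `y` of the edge to `z`. -/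
def perm (x y : Fin 5) : Equiv.Perm (Fin 4) :=
  (lab x).symm.trans <|
    ((Equiv.swap x y).subtypeEquiv (q := fun z => z ≠ y) (fun z => by
      rw [not_iff_not, Equiv.swap_apply_eq_iff, Equiv.swap_apply_right])).trans (lab y)

/-- The automorphism of `Z₂ × Z₂ × Z₂` which maps the generator of `L_i` to that of `L_{σ(i)}`, for
all `i`. -/
def lin (σ : Equiv.Perm (Fin 4)) : V ≃+ V where
  toFun a := a.1 • gen (σ 0) + a.2.1 • gen (σ 1) + a.2.2 • gen (σ 2)
  invFun a := a.1 • gen (σ.symm 0) + a.2.1 • gen (σ.symm 1) + a.2.2 • gen (σ.symm 2)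
  left_inv := by revert σ; decide
  right_inv := by revert σ; decide
  map_add' := by intro a b; simp only [Prod.fst_add, Prod.snd_add, add_smul]; abel

theorem lin_gen (σ : Equiv.Perm (Fin 4)) (i : Fin 4) : lin σ (gen i) = gen (σ i) := by
  revert σ i; decide

theorem perm_label {x y : Fin 5} (h : y ≠ x) :
    perm lab x y (lab x ⟨y, h⟩) = lab y ⟨x, h.symm⟩ := by
  simp [perm]

theorem map_L (σ : Equiv.Perm (Fin 4)) (i : Fin 4) :
    (L i).map ((lin σ).toMultiplicative : Z →* Z) = L (σ i) := by
  apply SetLike.coe_injective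
  change (fun a : Z => Multiplicative.ofAdd (lin σ a.toAdd)) '' {1, Multiplicative.ofAdd (gen i)} =
    {1, Multiplicative.ofAdd (gen (σ i))}
  rw [Set.image_pair]
  simp [lin_gen]

theorem map_sub (x y : Fin 5) :
    (sub lab x y).map ((lin (perm lab x y)).toMultiplicative : Z →* Z) = sub lab y x := by
  by_cases h : y = x
  · subst h; simp [sub]
  · rw [sub, dif_pos h, sub, dif_pos (Ne.symm h), map_L, perm_label]

/-- The quotient isomorphism `φ_xy`, induced by the above automorphism. -/
def pentagonIso (x y : Fin 5) : Z ⧸ sub lab x y ≃* Z ⧸ sub lab y x :=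
  QuotientGroup.congr _ _ (lin (perm lab x y)).toMultiplicative (map_sub lab x y)

/-- The group pair with the subgroups `H_xy`, `K_xy = H_yx` prescribed by the labelling, and given
quotient isomorphisms; the equivalence relation on the indices is the universal one. -/
def pentagonPair (ψ : ∀ x y : Fin 5, Z ⧸ sub lab x y ≃* Z ⧸ sub lab y x) :
    GroupPair (fun _ : Fin 5 => Z) where
  E := ⊤
  H x y := sub lab x y
  K x y := sub lab y x
  normalH _ _ := inferInstance
  normalK _ _ := inferInstance
  φ := fun {x y} _ => ψ x y

/-- The coset `C_xyz`: the complement of `H_xy ∘ H_xz` if `(x, y, z)` is a permutation of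
`(p, q, r)`, and `H_xy ∘ H_xz` itself otherwise. -/
def shift (x y z : Fin 5) : Set Z :=
  if ({x, y, z} : Finset (Fin 5)) = {0, 1, 2} then
    ((sub lab x y : Set Z) * (sub lab x z : Set Z))ᶜ
  else (sub lab x y : Set Z) * (sub lab x z : Set Z)

theorem mem_mul_iff {i j : Fin 4} (a : Z) : a ∈ (L i : Set Z) * (L j : Set Z) ↔
    a.toAdd ∈ ({0, gen i, gen j, gen i + gen j} : Finset V) := by
  change a ∈ ({1, Multiplicative.ofAdd (gen i)} : Set Z) * {1, Multiplicative.ofAdd (gen j)} ↔ _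
  simp only [Set.mem_mul, Set.mem_insert_iff, Set.mem_singleton_iff, exists_eq_or_imp,
    exists_eq_left, one_mul, mul_one, Finset.mem_insert, Finset.mem_singleton]
  constructor
  · rintro ((rfl | rfl) | (rfl | rfl)) <;> simp
  · rintro (h | h | h | h)
    · exact Or.inl (Or.inl h.symm)
    · exact Or.inr (Or.inl h.symm)
    · exact Or.inl (Or.inr h.symm)
    · exact Or.inr (Or.inr h.symm)

theorem compl_coset {i j : Fin 4} (h : i ≠ j) :
    ∃ g : Z, ((L i : Set Z) * (L j : Set Z))ᶜ = {g} * ((L i : Set Z) * (L j : Set Z)) := by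
  have key : ∀ i j : Fin 4, i ≠ j → ∃ g : V, ∀ a : V,
      a ∉ ({0, gen i, gen j, gen i + gen j} : Finset V) ↔
        -g + a ∈ ({0, gen i, gen j, gen i + gen j} : Finset V) := by
    decide
  obtain ⟨g, hg⟩ := key i j h
  refine ⟨Multiplicative.ofAdd g, Set.ext fun a => ?_⟩
  rw [Set.mem_compl_iff, mem_mul_iff, hg, Set.singleton_mul, Set.mem_image]
  constructor
  · intro h
    exact ⟨(Multiplicative.ofAdd g)⁻¹ * a, (mem_mul_iff _).2 h, mul_inv_cancel_left _ _⟩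
  · rintro ⟨b, hb, rfl⟩
    simpa using (mem_mul_iff _).1 hb

theorem shift_coset (x y z : Fin 5) :
    ∃ g : Z, shift lab x y z = {g} * ((sub lab x y : Set Z) * (sub lab x z : Set Z)) := by
  unfold shift
  split_ifs with h
  · have hd : ∀ x y z : Fin 5, ({x, y, z} : Finset (Fin 5)) = {0, 1, 2} →
        y ≠ x ∧ z ≠ x ∧ y ≠ z := by decide
    obtain ⟨h1, h2, h3⟩ := hd x y z h
    rw [sub, dif_pos h1, sub, dif_pos h2]
    exact compl_coset fun e => h3 (congrArg Subtype.val ((lab x).injective e))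
  · exact ⟨1, by rw [Set.singleton_one, one_mul]⟩

/-- The group triple of the example. -/
def pentagonTriple : GroupTriple (fun _ : Fin 5 => Z) where
  toGroupPair := pentagonPair lab (pentagonIso lab)
  C := shift lab
  coset x y z _ _ := shift_coset lab x y z

end CosetRA

/-! The four generators span Z₂³ and their only relation is that their sum is zero, so Z₂³ is Z₂⁴
modulo constant vectors. Indexing the four coordinates at x by the other vertices turns an element
of G_x into a Z₂-valued function on those vertices, up to a constant (`crd`, `ConstOff`). Then H_xy
consists of the functions constant off {x, y} (`mem_sub_iff`), and φ_xy matches functions that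
differ by a constant off {x, y} (`pentagonIso_mk_eq_iff`). The numbering has disappeared, and the
quotient of G_x by H_xy H_xz is the group of functions off {x, y, z} modulo constants, which is the
same at all three vertices. The frame conditions become bookkeeping of exempt sets, resting on
`ConstOff.glue`. The coset C_xyz is the class of a function `twist` that depends only on the set {x,
y, z}; the associativity condition is the cocycle identity `twist_assoc`.

An atom is now a triple (x, y, f), and R_xz,h lies below R_xy,f ⊗ R_yz,g exactly when f + g + h +
twist is constant off {x, y, z}. This condition is symmetric in the three edges, which makes the
relation algebra axioms short.

A representation would produce five points joined pairwise by atoms, that is, an edge labelling f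
for which f_xy + f_yz + f_xz + twist is constant off every triangle. Compare the values at the two
vertices outside each triangle and add over the ten triangles. An edge xy lies in three triangles,
whose outside pairs are the three pairs among the remaining three vertices, so all values of f_xy
cancel. Exactly one triangle has a nontrivial twist, so the total is 1 = 0
(`not_forall_constOff_twist`, `not_isHom_injective`). Full group relation algebras consist of
genuine relations, hence cannot contain the example. -/

namespace CosetRA

/-! ### Coordinates on the vertex groups -/

/-- `f` is constant off the set `A` of indices. -/
def ConstOff (A : Finset (Fin 5)) (f : Fin 5 → ZMod 2) : Prop := ∃ k, ∀ i ∉ A, f i = k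

instance (A : Finset (Fin 5)) (f : Fin 5 → ZMod 2) : Decidable (ConstOff A f) := by
  unfold ConstOff; infer_instance

namespace ConstOff

variable {A B : Finset (Fin 5)} {f g h : Fin 5 → ZMod 2}

theorem zero : ConstOff A 0 := ⟨0, fun _ _ => rfl⟩

theorem add_self : ConstOff A (f + f) := ⟨0, fun i _ => CharTwo.add_self_eq_zero (f i)⟩

theorem mono (hf : ConstOff A f) (hAB : A ⊆ B) : ConstOff B f := by
  obtain ⟨k, hk⟩ := hf
  exact ⟨k, fun i hi => hk i fun h => hi (hAB h)⟩

theorem add (hf : ConstOff A f) (hg : ConstOff A g) : ConstOff A (f + g) := by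
  obtain ⟨k, hk⟩ := hf
  obtain ⟨l, hl⟩ := hg
  exact ⟨k + l, fun i hi => by rw [Pi.add_apply, hk i hi, hl i hi]⟩

theorem of_add (hf : ConstOff A f) (hg : ConstOff A g) (e : f + g = h) : ConstOff A h :=
  e ▸ hf.add hg

/-- Let e follow g, up to the constant k, on A and follow f off A. This interpolation supplies all
the intermediate elements needed below: factors of a product of cosets, preimages under φ_xy, and
the middle atom in associativity. -/
theorem glue (hfg : ConstOff (A ∪ B) (f + g)) :
    ∃ e, ConstOff A (e + f) ∧ ConstOff B (e + g) := by
  obtain ⟨k, hk⟩ := hfg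
  refine ⟨fun i => if i ∈ A then g i + k else f i, ⟨0, fun i hi => ?_⟩, ⟨k, fun i hi => ?_⟩⟩
  · simp [hi, CharTwo.add_self_eq_zero]
  · by_cases hA : i ∈ A
    · simp only [Pi.add_apply, hA, if_true]
      grind
    · have := hk i (by simp [hA, hi])
      simpa [hA] using this

end ConstOff

/-- The coordinates of an element of `Z₂ × Z₂ × Z₂` with respect to the four generators, which are
determined up to an additive constant. -/
def wt (a : V) : Fin 4 → ZMod 2 := ![a.1, a.2.1, a.2.2, 0]

theorem wt_add (a b : V) (i : Fin 4) : wt (a + b) i = wt a i + wt b i := by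
  revert a b i; decide

/-- Permuting the generators permutes the coordinates; the constant k restores the normalisation
that the last coordinate is 0. -/
theorem wt_lin (σ : Equiv.Perm (Fin 4)) (a : V) :
    ∃ k, ∀ i, wt (lin σ a) (σ i) = wt a i + k := by
  revert σ a; decide

theorem mem_L_iff_wt (i : Fin 4) (a : Z) :
    a ∈ L i ↔ ∃ k, ∀ j, j ≠ i → wt a.toAdd j = k := by
  have key : ∀ (i : Fin 4) (a : V), (a = 0 ∨ a = gen i) ↔ ∃ k, ∀ j, j ≠ i → wt a j = k := by
    decide
  exact key i a

theorem eq_zero_iff_wt (a : V) : a = 0 ↔ ∃ k, ∀ j, wt a j = k := by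
  revert a; decide

theorem exists_wt (f : Fin 4 → ZMod 2) : ∃ a, ∃ k, ∀ i, wt a i = f i + k := by
  refine ⟨(f 0 + f 3, f 1 + f 3, f 2 + f 3), f 3, fun i => ?_⟩
  fin_cases i <;> simp [wt, CharTwo.add_self_eq_zero]

variable (lab : Labelling)

/-- The coordinates of an element of the group at `x`, indexed by the vertices other than `x`. -/
def crd (x : Fin 5) (a : Z) (y : Fin 5) : ZMod 2 :=
  if h : y ≠ x then wt a.toAdd (lab x ⟨y, h⟩) else 0

theorem crd_mul (x : Fin 5) (a b : Z) : crd lab x (a * b) = crd lab x a + crd lab x b := by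
  funext y
  by_cases h : y = x <;> simp [crd, h, wt_add]

theorem crd_one (x : Fin 5) : crd lab x 1 = 0 := by
  have := crd_mul lab x 1 1
  rw [mul_one] at this
  exact left_eq_add.1 this

theorem crd_inv (x : Fin 5) (a : Z) : crd lab x a⁻¹ = crd lab x a := by
  have h := crd_mul lab x a a⁻¹
  rw [mul_inv_cancel, crd_one] at h
  funext y
  have h := congrFun h y
  simp only [Pi.zero_apply, Pi.add_apply] at h
  grind

/-- Every function is realised because the default value 0 of `crd` at x itself is exempt when x ∈
A. -/
theorem exists_crd {A : Finset (Fin 5)} {x : Fin 5} (hx : x ∈ A) (f : Fin 5 → ZMod 2) :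
    ∃ a, ConstOff A (crd lab x a + f) := by
  obtain ⟨a, k, hk⟩ := exists_wt fun i => f ((lab x).symm i)
  refine ⟨Multiplicative.ofAdd a, k, fun i hi => ?_⟩
  have hix : i ≠ x := by rintro rfl; exact hi hx
  simp only [Pi.add_apply, crd, dif_pos hix, toAdd_ofAdd, hk, Equiv.symm_apply_apply]
  grind

/-- Adding the generator labelled by the edge to y changes only the coordinate at y. For y = x only
constants remain, which is the trivial group, so the diagonal needs no separate treatment
afterwards. -/
theorem mem_sub_iff (x y : Fin 5) (a : Z) :
    a ∈ sub lab x y ↔ ConstOff {x, y} (crd lab x a) := by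
  have hsymm : ∀ i, ((lab x).symm i : Fin 5) ≠ x := fun i => ((lab x).symm i).2
  by_cases h : y = x
  · subst h
    rw [sub, dif_neg (by simp), Subgroup.mem_bot]
    refine (eq_zero_iff_wt a.toAdd).trans ⟨?_, ?_⟩ <;> rintro ⟨k, hk⟩ <;> refine ⟨k, fun i => ?_⟩
    · intro hi
      simp only [Finset.mem_insert, Finset.mem_singleton, or_self] at hi
      simp [crd, hi, hk]
    · have := hk ((lab y).symm i) (by simp [hsymm])
      simpa [crd, hsymm] using this
  · rw [sub, dif_pos h, mem_L_iff_wt]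
    constructor <;> rintro ⟨k, hk⟩ <;> refine ⟨k, fun i hi => ?_⟩
    · simp only [Finset.mem_insert, Finset.mem_singleton, not_or] at hi
      simp only [crd, ne_eq, hi.1, not_false_eq_true, dif_pos]
      exact hk _ fun e => hi.2 (congrArg Subtype.val ((lab x).injective e))
    · have := hk ((lab x).symm i) (by
        simp only [Finset.mem_insert, Finset.mem_singleton, hsymm, false_or]
        rintro rfl
        simp at hi)
      simpa [crd, hsymm] using this

/-- For a third vertex z, `perm` carries the label of z at x to the label of z at y, so the
coordinate at z is preserved up to the common constant. -/
theorem crd_lin (x y : Fin 5) (a : Z) :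
    ConstOff {x, y} (crd lab x a +
      crd lab y (Multiplicative.ofAdd (lin (perm lab x y) a.toAdd))) := by
  obtain ⟨k, hk⟩ := wt_lin (perm lab x y) a.toAdd
  refine ⟨k, fun i hi => ?_⟩
  simp only [Finset.mem_insert, Finset.mem_singleton, not_or] at hi
  have hp : perm lab x y (lab x ⟨i, hi.1⟩) = lab y ⟨i, hi.2⟩ := by
    simp [perm, Equiv.swap_apply_of_ne_of_ne hi.1 hi.2]
  have := hk (lab x ⟨i, hi.1⟩)
  rw [hp] at this
  simp only [Pi.add_apply, crd, ne_eq, hi.1, hi.2, not_false_eq_true, dif_pos, toAdd_ofAdd, this]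
  grind

theorem mk_eq_mk_iff (x y : Fin 5) (a b : Z) :
    (a : Z ⧸ sub lab x y) = b ↔ ConstOff {x, y} (crd lab x a + crd lab x b) := by
  rw [QuotientGroup.eq, mem_sub_iff, crd_mul, crd_inv]

theorem pentagonIso_mk_eq_iff (x y : Fin 5) (a b : Z) :
    pentagonIso lab x y (a : Z ⧸ sub lab x y) = (b : Z ⧸ sub lab y x) ↔
      ConstOff {x, y} (crd lab x a + crd lab y b) := by
  have h : pentagonIso lab x y (a : Z ⧸ sub lab x y) =
    ((Multiplicative.ofAdd (lin (perm lab x y) a.toAdd) : Z) : Z ⧸ sub lab y x) := rfl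
  have hl := crd_lin lab x y a
  rw [h, mk_eq_mk_iff, Finset.pair_comm]
  constructor <;> intro h' <;> refine h'.of_add hl ?_ <;> funext i <;>
    simp only [Pi.add_apply] <;> grind

/-! ### Cosets in coordinates -/

/-- The set of elements of the group at `x` whose coordinates agree with `f` off `A`, up to an
additive constant. -/
def cst (x : Fin 5) (A : Finset (Fin 5)) (f : Fin 5 → ZMod 2) : Set Z :=
  {a | ConstOff A (crd lab x a + f)}

variable {lab}

theorem cst_congr {x : Fin 5} {A B : Finset (Fin 5)} {f g : Fin 5 → ZMod 2} (hAB : A = B)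
    (h : ConstOff A (f + g)) : cst lab x A f = cst lab x B g := by
  subst hAB
  ext a
  constructor <;> intro h' <;> refine ConstOff.of_add h' h ?_ <;> funext i <;>
    simp only [Pi.add_apply] <;> grind

theorem sub_eq_cst (x y : Fin 5) : (sub lab x y : Set Z) = cst lab x {x, y} 0 := by
  ext a
  simp [mem_sub_iff, cst]

theorem singleton_eq_cst (x : Fin 5) (g : Z) : {g} = cst lab x {x} (crd lab x g) := by
  ext a
  have := mk_eq_mk_iff lab x x a g
  simp only [Finset.pair_eq_singleton] at this
  rw [cst, Set.mem_ofPred_eq, ← this, QuotientGroup.eq, sub, dif_neg (by simp), Subgroup.mem_bot,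
    inv_mul_eq_one, Set.mem_singleton_iff]

/-- A product of cosets adds the functions and unites the exempt sets. For the nontrivial inclusion,
gluing gives a first factor b, and b⁻¹a is the second. -/
theorem cst_mul_cst {x : Fin 5} {A B : Finset (Fin 5)} (hA : x ∈ A) (hB : x ∈ B)
    (f g : Fin 5 → ZMod 2) : cst lab x A f * cst lab x B g = cst lab x (A ∪ B) (f + g) := by
  ext a
  constructor
  · rintro ⟨b, hb, c, hc, rfl⟩
    refine (ConstOff.mono hb Finset.subset_union_left).of_add
      (ConstOff.mono hc Finset.subset_union_right) ?_
    rw [crd_mul]; abel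
  · intro h
    have h' : ConstOff (A ∪ B) (f + (crd lab x a + g)) := by
      convert ← (show ConstOff _ _ from h) using 1; abel
    obtain ⟨e, he, he'⟩ := h'.glue
    obtain ⟨b, hb⟩ := exists_crd lab (A := {x}) (x := x) (by simp) e
    refine ⟨b, (hb.mono (by simpa using hA)).of_add he ?_, b⁻¹ * a,
      (hb.mono (by simpa using hB)).of_add he' ?_, by simp⟩ <;> funext i <;>
      simp only [crd_mul, crd_inv, Pi.add_apply] <;> grind

theorem cst_inv (x : Fin 5) (A : Finset (Fin 5)) (f : Fin 5 → ZMod 2) :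
    (cst lab x A f)⁻¹ = cst lab x A f := by
  ext a
  simp [cst, crd_inv]

/-- The function that represents the coset `C_xyz`, where `A = {x, y, z}`. -/
def twist (A : Finset (Fin 5)) : Fin 5 → ZMod 2 := if A = {0, 1, 2} then Pi.single 3 1 else 0

/-- Off {0, 1, 2} only the vertices 3 and 4 remain, so there are two functions modulo constants; the
complement of the subgroup is the class of the indicator of 3. -/
theorem shift_eq_cst (x y z : Fin 5) :
    shift lab x y z = cst lab x {x, y, z} (twist {x, y, z}) := by
  have h : cst lab x {x, y} 0 * cst lab x {x, z} 0 = cst lab x {x, y, z} 0 := by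
    rw [cst_mul_cst (by simp) (by simp)]
    exact cst_congr (by ext; simp) (by simpa using ConstOff.zero)
  unfold shift twist
  rw [sub_eq_cst, sub_eq_cst, h]
  split_ifs with hA
  · rw [hA]
    ext a
    have key : ∀ f : Fin 5 → ZMod 2,
        ¬ ConstOff {0, 1, 2} (f + 0) ↔ ConstOff {0, 1, 2} (f + Pi.single 3 1) := by decide
    exact key _
  · rfl

/-! ### The frame conditions -/

theorem pentagonPair_rel {ψ : ∀ x y : Fin 5, Z ⧸ sub lab x y ≃* Z ⧸ sub lab y x} (x y : Fin 5) :
    (pentagonPair lab ψ).E.r x y := trivial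

/-- Since φ_xy keeps the coordinates off {x, y}, the image has the same function and a larger exempt
set. -/
theorem img_cst {x y : Fin 5} (h : (pentagonPair lab (pentagonIso lab)).E.r x y)
    {A : Finset (Fin 5)} (hA : x ∈ A) (f : Fin 5 → ZMod 2) :
    (pentagonPair lab (pentagonIso lab)).img h (cst lab x A f) = cst lab y (A ∪ {x, y}) f := by
  ext b
  constructor
  · rintro ⟨a, ha, e⟩
    have e := (pentagonIso_mk_eq_iff lab x y a b).1 e
    refine (ConstOff.mono ha Finset.subset_union_left).of_add
      (e.mono Finset.subset_union_right) ?_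
    funext i; simp only [Pi.add_apply]; grind
  · intro hb
    have h' : ConstOff (A ∪ {x, y}) (f + crd lab y b) := add_comm (crd lab y b) f ▸ hb
    obtain ⟨e, he, he'⟩ := h'.glue
    obtain ⟨a, ha⟩ := exists_crd lab (A := {x}) (x := x) (by simp) e
    refine ⟨a, (ha.mono (by simpa using hA)).of_add he ?_, (pentagonIso_mk_eq_iff lab x y a b).2
      ((ha.mono (by simp)).of_add he' ?_)⟩ <;> funext i <;> simp only [Pi.add_apply] <;> grind

theorem preimg_cst {x y : Fin 5} (h : (pentagonPair lab (pentagonIso lab)).E.r x y)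
    {A : Finset (Fin 5)} (hA : y ∈ A) (f : Fin 5 → ZMod 2) :
    (pentagonPair lab (pentagonIso lab)).preimg h (cst lab y A f) =
      cst lab x (A ∪ {x, y}) f := by
  rw [Finset.pair_comm, ← img_cst (lab := lab) (x := y) (y := x) h hA]
  ext a
  refine exists_congr fun b => and_congr_right fun _ => ?_
  refine (pentagonIso_mk_eq_iff lab x y a b).trans (Iff.trans ?_
    (pentagonIso_mk_eq_iff lab y x b a).symm)
  rw [Finset.pair_comm, add_comm]

theorem sub_mul_sub (x y z : Fin 5) :
    (sub lab x y : Set Z) * (sub lab x z : Set Z) = cst lab x {x, y, z} 0 := by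
  rw [sub_eq_cst, sub_eq_cst, cst_mul_cst (by simp) (by simp)]
  exact cst_congr (by ext; simp) (by simpa using ConstOff.zero)

theorem preFrame_pentagonIso (lab : Labelling) :
    (pentagonPair lab (pentagonIso lab)).PreFrame where
  refl x a b := by
    refine (pentagonIso_mk_eq_iff lab x x a b).trans ?_
    rw [← mk_eq_mk_iff, QuotientGroup.eq, sub, dif_neg (by simp), Subgroup.mem_bot,
      inv_mul_eq_one]
  symm {x y} h a b := by
    refine (pentagonIso_mk_eq_iff lab y x b a).trans (Iff.trans ?_
      (pentagonIso_mk_eq_iff lab x y a b).symm)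
    rw [Finset.pair_comm, add_comm]
  img_mul {x y z} h h' := by
    change GroupPair.img _ h ((sub lab x y : Set Z) * (sub lab x z : Set Z)) =
      (sub lab y x : Set Z) * (sub lab y z : Set Z)
    rw [sub_mul_sub, sub_mul_sub, img_cst h (by simp)]
    exact cst_congr (by ext; simp; tauto) (by simpa using ConstOff.zero)

theorem coset_eq_cst (x y z : Fin 5) (g : Z) :
    {g} * ((sub lab x y : Set Z) * (sub lab x z : Set Z)) =
      cst lab x {x, y, z} (crd lab x g) := by
  rw [sub_mul_sub, singleton_eq_cst (lab := lab) x g, cst_mul_cst (by simp) (by simp)]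
  exact cst_congr (by ext; simp; tauto) (by simpa using ConstOff.add_self)

theorem isGroupFrame_pentagonIso (lab : Labelling) :
    (pentagonPair lab (pentagonIso lab)).IsGroupFrame where
  toPreFrame := preFrame_pentagonIso lab
  img_mul' {x y z} h h' := by
    change GroupPair.img _ h' ((sub lab y x : Set Z) * (sub lab y z : Set Z)) =
      (sub lab z x : Set Z) * (sub lab z y : Set Z)
    rw [sub_mul_sub, sub_mul_sub, img_cst h' (by simp)]
    exact cst_congr (by ext; simp; tauto) (by simpa using ConstOff.zero)
  img_img {x y z} h h' g D hD := by
    have hD : D = {g} * ((sub lab x y : Set Z) * (sub lab x z : Set Z)) := hD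
    rw [hD, coset_eq_cst, img_cst h (by simp), img_cst h' (by simp), img_cst _ (by simp)]
    exact cst_congr (by ext; simp) ConstOff.add_self

theorem isSemiFrame_pentagonTriple (lab : Labelling) : (pentagonTriple lab).IsSemiFrame where
  toPreFrame := preFrame_pentagonIso lab
  img_img {x y z} h h' g D hD := by
    have hD : D = {g} * ((sub lab x y : Set Z) * (sub lab x z : Set Z)) := hD
    change GroupPair.img (pentagonPair lab (pentagonIso lab)) (pentagonPair_rel y z)
      (GroupPair.img (pentagonPair lab (pentagonIso lab)) (pentagonPair_rel x y) D) =
      GroupPair.img (pentagonPair lab (pentagonIso lab)) (pentagonPair_rel x z)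
        ((shift lab x y z)⁻¹ * D * shift lab x y z)
    rw [hD, coset_eq_cst, shift_eq_cst, cst_inv, cst_mul_cst (by simp) (by simp),
      cst_mul_cst (by simp) (by simp), img_cst h (by simp), img_cst h' (by simp),
      img_cst _ (by simp)]
    refine cst_congr (by ext; simp) (ConstOff.of_add ConstOff.zero ConstOff.zero ?_)
    funext i; simp only [Pi.add_apply, Pi.zero_apply]; grind

/-- For four distinct vertices a single vertex remains outside, and every function on it is
constant. If two vertices coincide, the twists of sets with at most two elements vanish and the
other two terms are equal. -/
theorem twist_assoc (x y z w : Fin 5) : ConstOff {x, y, z, w}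
    (twist {x, y, z} + twist {x, z, w} + (twist {y, z, w} + twist {x, y, w})) := by
  revert x y z w; decide

theorem cosetConditions_pentagonTriple (lab : Labelling) :
    (pentagonTriple lab).CosetConditions where
  identity x y _ := by
    change shift lab x y y = (sub lab x y : Set Z)
    have h : ∀ x y : Fin 5, twist {x, y, y} = 0 := by decide
    rw [shift_eq_cst, sub_eq_cst, h]
    exact cst_congr (by ext; simp) ConstOff.zero
  involution {x y z} h h' := by
    change GroupPair.img (pentagonPair lab (pentagonIso lab)) (pentagonPair_rel x z)
      (shift lab x y z) =
      (shift lab z y x)⁻¹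
    have hs : ({z, y, x} : Finset (Fin 5)) = {x, y, z} := by ext; simp; tauto
    rw [shift_eq_cst, shift_eq_cst, cst_inv, img_cst _ (by simp), hs]
    exact cst_congr (by ext; simp) ConstOff.add_self
  cycle {x y z} h h' := by
    change GroupPair.img (pentagonPair lab (pentagonIso lab)) (pentagonPair_rel x y)
      (shift lab x y z) =
      (shift lab y x z)⁻¹
    have hs : ({y, x, z} : Finset (Fin 5)) = {x, y, z} := by ext; simp; tauto
    rw [shift_eq_cst, shift_eq_cst, cst_inv, img_cst _ (by simp), hs]
    exact cst_congr (by ext; simp; tauto) ConstOff.add_self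
  assoc {x y z w} h h' h'' := by
    change shift lab x y z * shift lab x z w =
      GroupPair.img (pentagonPair lab (pentagonIso lab)) (pentagonPair_rel y x)
        (shift lab y z w * (sub lab y x : Set Z)) * shift lab x y w
    rw [shift_eq_cst, shift_eq_cst, shift_eq_cst, shift_eq_cst, sub_eq_cst,
      cst_mul_cst (by simp) (by simp), cst_mul_cst (by simp) (by simp), img_cst _ (by simp),
      cst_mul_cst (by simp) (by simp), add_zero]
    exact cst_congr (by ext; simp; tauto)
      ((twist_assoc x y z w).mono fun i => by simp)

/-! ### Uniqueness of the quotient isomorphisms -/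

/-- Given two vertices i, j off {x, y}, take z to be the third one. Constancy off {x, y, z} then
says f i = f j, and over Z₂ the equivalence with g i = g j forces f i + f j = g i + g j. -/
theorem constOff_add_of_forall {x y : Fin 5} (hxy : x ≠ y) {f g : Fin 5 → ZMod 2}
    (h : ∀ z, ConstOff {x, y, z} f ↔ ConstOff {x, y, z} g) : ConstOff {x, y} (f + g) := by
  have key : ∀ x y i j : Fin 5, x ≠ y → i ≠ j → i ∉ ({x, y} : Finset (Fin 5)) →
      j ∉ ({x, y} : Finset (Fin 5)) → ∃ z : Fin 5, ∀ w, w ∉ ({x, y, z} : Finset (Fin 5)) ↔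
        w = i ∨ w = j := by decide
  have h2 : ∀ i j, i ∉ ({x, y} : Finset (Fin 5)) → j ∉ ({x, y} : Finset (Fin 5)) →
      f i + g i = f j + g j := by
    intro i j hi hj
    by_cases hij : i = j
    · rw [hij]
    obtain ⟨z, hz⟩ := key x y i j hxy hij hi hj
    have hc : ∀ f : Fin 5 → ZMod 2, ConstOff {x, y, z} f ↔ f i = f j := by
      intro f
      constructor
      · rintro ⟨k, hk⟩
        rw [hk i ((hz i).2 (Or.inl rfl)), hk j ((hz j).2 (Or.inr rfl))]
      · intro e
        refine ⟨f j, fun w hw => ?_⟩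
        obtain rfl | rfl := (hz w).1 hw
        · exact e
        · rfl
    have h3 := h z
    rw [hc, hc] at h3
    generalize f i = a, f j = b, g i = c, g j = d at h3
    revert a b c d
    decide
  have hex : ∀ x y : Fin 5, ∃ i, i ∉ ({x, y} : Finset (Fin 5)) := by decide
  obtain ⟨i, hi⟩ := hex x y
  exact ⟨f i + g i, fun j hj => h2 j i hj hi⟩

/-- Condition (i) settles the diagonal. Off it, the first half of (iii) suffices: an isomorphism
taking H_xy H_xz to H_yx H_yz for every z preserves all the tests of constancy off {x, y, z}, and
these determine the class. -/
theorem eq_pentagonIso {ψ : ∀ x y : Fin 5, Z ⧸ sub lab x y ≃* Z ⧸ sub lab y x}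
    (hψ : (pentagonPair lab ψ).PreFrame) : ψ = pentagonIso lab := by
  funext x y
  refine MulEquiv.ext fun q => ?_
  obtain ⟨a, rfl⟩ := QuotientGroup.mk_surjective q
  obtain ⟨b, hb⟩ := QuotientGroup.mk_surjective (ψ x y (a : Z ⧸ sub lab x y))
  rw [← hb]
  symm
  rw [pentagonIso_mk_eq_iff]
  by_cases hxy : x = y
  · subst hxy
    have : a = b := (hψ.refl x a b).1 hb.symm
    subst this
    exact ConstOff.add_self
  refine constOff_add_of_forall hxy fun z => ?_
  have himg : GroupPair.img (pentagonPair lab ψ) (x := x) (y := y) trivial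
      ((sub lab x y : Set Z) * (sub lab x z : Set Z)) =
      (sub lab y x : Set Z) * (sub lab y z : Set Z) :=
    hψ.img_mul (x := x) (y := y) (z := z) trivial trivial
  have hs : ({y, x, z} : Finset (Fin 5)) = {x, y, z} := by ext; simp; tauto
  rw [sub_mul_sub, sub_mul_sub, hs] at himg
  have hb' : b ∈ cst lab y {x, y, z} 0 ↔ a ∈ cst lab x {x, y, z} 0 := by
    rw [← himg]
    constructor
    · rintro ⟨a', ha', e⟩
      have e : ψ x y (a' : Z ⧸ sub lab x y) = b := e
      have e' := (ψ x y).injective (e.trans hb)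
      rw [mk_eq_mk_iff] at e'
      refine ConstOff.of_add ha' (e'.mono fun i => by simp; tauto) ?_
      funext i; simp only [Pi.add_apply]; grind
    · intro ha
      exact ⟨a, ha, hb.symm⟩
  simpa [cst] using hb'.symm

theorem isGroupFrame_iff (ψ : ∀ x y : Fin 5, Z ⧸ sub lab x y ≃* Z ⧸ sub lab y x) :
    (pentagonPair lab ψ).IsGroupFrame ↔ ψ = pentagonIso lab :=
  ⟨fun h => eq_pentagonIso h.toPreFrame, fun h => h ▸ isGroupFrame_pentagonIso lab⟩

/-! ### The coset relation algebra in coordinates -/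

variable (lab)

/-- The relation `R_{xy,α}`, where `α` is given by the coordinates `f`. -/
def atomRel (x y : Fin 5) (f : Fin 5 → ZMod 2) : SetRel (Σ _ : Fin 5, Z) (Σ _ : Fin 5, Z) :=
  {p | p.1.1 = x ∧ p.2.1 = y ∧ ConstOff {x, y} (crd lab x p.1.2 + crd lab y p.2.2 + f)}

variable {lab}

theorem mk_mem_atomRel {x y : Fin 5} {f : Fin 5 → ZMod 2} {a b : Z} :
    ((⟨x, a⟩, ⟨y, b⟩) : (Σ _ : Fin 5, Z) × (Σ _ : Fin 5, Z)) ∈ atomRel lab x y f ↔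
      ConstOff {x, y} (crd lab x a + crd lab y b + f) :=
  ⟨fun h => h.2.2, fun h => ⟨rfl, rfl, h⟩⟩

theorem self_mem_atomRel (x y : Fin 5) (a b : Z) :
    ((⟨x, a⟩, ⟨y, b⟩) : (Σ _ : Fin 5, Z) × (Σ _ : Fin 5, Z)) ∈
      atomRel lab x y (crd lab x a + crd lab y b) :=
  mk_mem_atomRel.2 ConstOff.add_self

theorem atom_eq_atomRel {x y : Fin 5} (h : (pentagonTriple lab).E.r x y) (c : Z) :
    (pentagonTriple lab).atom h (c : Z ⧸ sub lab x y) = atomRel lab x y (crd lab x c) := by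
  ext ⟨⟨x', a⟩, ⟨y', b⟩⟩
  have key : ∀ a b : Z, pentagonIso lab x y ((a : Z ⧸ sub lab x y) * (c : Z ⧸ sub lab x y)) =
      (b : Z ⧸ sub lab y x) ↔ ConstOff {x, y} (crd lab x a + crd lab y b + crd lab x c) := by
    intro a b
    rw [← QuotientGroup.mk_mul, pentagonIso_mk_eq_iff, crd_mul, add_right_comm]
  constructor
  · rintro ⟨a, b, e, h'⟩
    cases e
    exact mk_mem_atomRel.2 ((key a b).1 h')
  · rintro ⟨h1, h2, h3⟩
    dsimp only at h1 h2
    subst h1 h2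
    exact ⟨a, b, rfl, (key a b).2 h3⟩

theorem atomRel_congr {x y : Fin 5} {f g : Fin 5 → ZMod 2} (h : ConstOff {x, y} (f + g)) :
    atomRel lab x y f = atomRel lab x y g := by
  ext p
  refine and_congr_right fun _ => and_congr_right fun _ => ?_
  constructor <;> intro h' <;> refine h'.of_add h ?_ <;> funext i <;>
    simp only [Pi.add_apply] <;> grind

variable (lab) in
theorem exists_mem_atomRel (x y : Fin 5) (f : Fin 5 → ZMod 2) :
    ∃ a b, ((⟨x, a⟩, ⟨y, b⟩) : (Σ _ : Fin 5, Z) × (Σ _ : Fin 5, Z)) ∈ atomRel lab x y f := by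
  obtain ⟨a, ha⟩ := exists_crd lab (A := {x, y}) (x := x) (by simp) f
  exact ⟨a, 1, mk_mem_atomRel.2 (by simpa [crd_one] using ha)⟩

theorem atomRel_mem_atoms (x y : Fin 5) (f : Fin 5 → ZMod 2) :
    atomRel lab x y f ∈ (pentagonTriple lab).atoms := by
  obtain ⟨a, ha⟩ := exists_crd lab (A := {x, y}) (x := x) (by simp) f
  exact ⟨x, y, pentagonPair_rel x y, (a : Z ⧸ sub lab x y),
    ((atom_eq_atomRel _ a).trans (atomRel_congr ha)).symm⟩

theorem atomRel_mem_relations (x y : Fin 5) (f : Fin 5 → ZMod 2) :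
    atomRel lab x y f ∈ (pentagonTriple lab).relations :=
  ⟨{atomRel lab x y f}, by simpa using atomRel_mem_atoms x y f, by simp⟩

/-! ### Frame relations as unions of coordinate atoms, and their products -/

section relations

variable {X Y : SetRel (Σ _ : Fin 5, Z) (Σ _ : Fin 5, Z)}

theorem atomRel_subset_of_mem (hX : X ∈ (pentagonTriple lab).relations) {x y : Fin 5}
    {f : Fin 5 → ZMod 2} {p : (Σ _ : Fin 5, Z) × (Σ _ : Fin 5, Z)} (hp : p ∈ atomRel lab x y f)
    (h : p ∈ X) : atomRel lab x y f ⊆ X :=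
  (GroupPair.mem_relations_iff.1 hX).2 _ (atomRel_mem_atoms x y f) p hp h

theorem mk_mem_iff (hX : X ∈ (pentagonTriple lab).relations) {x y : Fin 5} {a b : Z} :
    ((⟨x, a⟩, ⟨y, b⟩) : (Σ _ : Fin 5, Z) × (Σ _ : Fin 5, Z)) ∈ X ↔
      atomRel lab x y (crd lab x a + crd lab y b) ⊆ X :=
  ⟨atomRel_subset_of_mem hX (self_mem_atomRel x y a b), fun h => h (self_mem_atomRel x y a b)⟩

theorem subset_of_atomRel (hX : X ∈ (pentagonTriple lab).relations)
    (h : ∀ x y f, atomRel lab x y f ⊆ X → atomRel lab x y f ⊆ Y) : X ⊆ Y := by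
  rintro ⟨⟨x, a⟩, ⟨y, b⟩⟩ hp
  exact h _ _ _ ((mk_mem_iff hX).1 hp) (self_mem_atomRel x y a b)

theorem ext_atomRel (hX : X ∈ (pentagonTriple lab).relations)
    (hY : Y ∈ (pentagonTriple lab).relations)
    (h : ∀ x y f, atomRel lab x y f ⊆ X ↔ atomRel lab x y f ⊆ Y) : X = Y :=
  (subset_of_atomRel hX fun x y f => (h x y f).1).antisymm
    (subset_of_atomRel hY fun x y f => (h x y f).2)

theorem atomRel_subset_union (hX : X ∈ (pentagonTriple lab).relations)
    (hY : Y ∈ (pentagonTriple lab).relations) {x y : Fin 5} {f : Fin 5 → ZMod 2} :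
    atomRel lab x y f ⊆ X ∪ Y ↔ atomRel lab x y f ⊆ X ∨ atomRel lab x y f ⊆ Y := by
  constructor
  · intro h
    obtain ⟨a, b, hab⟩ := exists_mem_atomRel lab x y f
    exact (h hab).imp (atomRel_subset_of_mem hX hab) (atomRel_subset_of_mem hY hab)
  · rintro (h | h)
    · exact h.trans Set.subset_union_left
    · exact h.trans Set.subset_union_right

/-- The condition defining `atomRel` is symmetric in its endpoints, so converse swaps x and y and
keeps f. -/
theorem atomRel_subset_inv {x y : Fin 5} {f : Fin 5 → ZMod 2} :
    atomRel lab x y f ⊆ SetRel.inv X ↔ atomRel lab y x f ⊆ X := by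
  have h : SetRel.inv (atomRel lab y x f) = atomRel lab x y f := by
    ext p
    change _ ∧ _ ∧ _ ↔ _ ∧ _ ∧ _
    rw [Finset.pair_comm, add_comm (crd lab y _)]
    tauto
  rw [← h]
  exact ⟨fun h' p hp => h' (a := (p.2, p.1)) hp, fun h' p hp => h' hp⟩

theorem mk_mem_id {x y : Fin 5} {a b : Z} :
    ((⟨x, a⟩, ⟨y, b⟩) : (Σ _ : Fin 5, Z) × (Σ _ : Fin 5, Z)) ∈
      (SetRel.id : SetRel (Σ _ : Fin 5, Z) (Σ _ : Fin 5, Z)) ↔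
      x = y ∧ ConstOff {x, y} (crd lab x a + crd lab y b) := by
  change (⟨x, a⟩ : Σ _ : Fin 5, Z) = ⟨y, b⟩ ↔ _
  rw [Sigma.mk.injEq, heq_eq_eq]
  refine and_congr_right ?_
  rintro rfl
  rw [← mk_eq_mk_iff, QuotientGroup.eq, sub, dif_neg (by simp), Subgroup.mem_bot, inv_mul_eq_one]

theorem atomRel_subset_id {x y : Fin 5} {f : Fin 5 → ZMod 2} :
    atomRel lab x y f ⊆ SetRel.id ↔ x = y ∧ ConstOff {x, y} f := by
  constructor
  · intro h
    obtain ⟨a, b, hab⟩ := exists_mem_atomRel lab x y f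
    obtain ⟨e, h'⟩ := (mk_mem_id (lab := lab)).1 (h hab)
    refine ⟨e, h'.of_add (mk_mem_atomRel.1 hab) ?_⟩
    funext i; simp only [Pi.add_apply]; grind
  · rintro ⟨rfl, hf⟩ ⟨⟨x', a⟩, ⟨y', b⟩⟩ ⟨h1, h2, h3⟩
    dsimp only at h1 h2 h3
    subst h1 h2
    refine (mk_mem_id (lab := lab)).2 ⟨rfl, h3.of_add hf ?_⟩
    funext i; simp only [Pi.add_apply]; grind

theorem mk_surjective_crd (x y : Fin 5) (α : Z ⧸ sub lab x y) :
    ∃ a : Z, (a : Z ⧸ sub lab x y) = α := QuotientGroup.mk_surjective α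

theorem cosetH_mk (x y : Fin 5) (a : Z) :
    (pentagonPair lab (pentagonIso lab)).cosetH (x := x) (y := y) (a : Z ⧸ sub lab x y) =
      cst lab x {x, y} (crd lab x a) := by
  ext b
  exact mk_eq_mk_iff lab x y b a

theorem cosetK_mk (x y : Fin 5) (a : Z) :
    (pentagonPair lab (pentagonIso lab)).cosetK (x := x) (y := y)
      (pentagonIso lab x y (a : Z ⧸ sub lab x y)) = cst lab y {x, y} (crd lab x a) := by
  ext b
  refine eq_comm.trans ((pentagonIso_mk_eq_iff lab x y a b).trans ?_)
  rw [add_comm]; rfl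

theorem cosetH_subset_iff (x y z : Fin 5) (a b c : Z) :
    (pentagonPair lab (pentagonIso lab)).cosetH (x := x) (y := z) (c : Z ⧸ sub lab x z) ⊆
      (pentagonPair lab (pentagonIso lab)).preimg (pentagonPair_rel x y)
        ((pentagonPair lab (pentagonIso lab)).cosetK (x := x) (y := y)
          (pentagonIso lab x y (a : Z ⧸ sub lab x y)) *
        (pentagonPair lab (pentagonIso lab)).cosetH (x := y) (y := z) (b : Z ⧸ sub lab y z)) *
        shift lab x y z ↔
    ConstOff {x, y, z} (crd lab x a + crd lab y b + crd lab x c + twist {x, y, z}) := by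
  rw [cosetH_mk, cosetH_mk, cosetK_mk, cst_mul_cst (by simp) (by simp), preimg_cst _ (by simp),
    shift_eq_cst, cst_mul_cst (by simp) (by simp)]
  have hs : ({x, y} ∪ {y, z} ∪ {x, y} ∪ {x, y, z} : Finset (Fin 5)) = {x, y, z} := by
    ext; simp
  rw [hs]
  constructor
  · intro h
    -- The inclusion of a whole coset is tested on its representative c.
    have : ConstOff _ _ := h (a := c) ConstOff.add_self
    convert this using 1
    abel
  · intro h d hd
    refine (ConstOff.mono hd fun i => by simp; tauto).of_add h ?_
    funext i; simp only [Pi.add_apply]; grind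

/-- The multiplication table on which all the axioms rest: characteristic two makes the condition on
f, g, h invariant under permuting the sides of the triangle. -/
theorem atomRel_subset_otimes {x z : Fin 5} {h : Fin 5 → ZMod 2} :
    atomRel lab x z h ⊆ (pentagonTriple lab).otimes X Y ↔
      ∃ y f g, atomRel lab x y f ⊆ X ∧ atomRel lab y z g ⊆ Y ∧
        ConstOff {x, y, z} (f + g + h + twist {x, y, z}) := by
  constructor
  · intro hs
    obtain ⟨a, b, hab⟩ := exists_mem_atomRel lab x z h
    obtain ⟨_, ⟨x', y, z', h1, h2, α, β, γ, hα, hβ, hγ, rfl⟩, hp⟩ := hs hab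
    obtain ⟨a', rfl⟩ := mk_surjective_crd _ _ α
    obtain ⟨b', rfl⟩ := mk_surjective_crd _ _ β
    obtain ⟨c', rfl⟩ := mk_surjective_crd _ _ γ
    have hγ := (cosetH_subset_iff x' y z' a' b' c').1 hγ
    rw [atom_eq_atomRel] at hα hβ hp
    obtain ⟨e1, e2, hp⟩ := hp
    dsimp only at e1 e2
    subst e1 e2
    refine ⟨y, _, _, hα, hβ, ?_⟩
    have := ConstOff.add hp (mk_mem_atomRel.1 hab)
    refine hγ.of_add (this.mono fun i => by simp; tauto) ?_
    funext i; simp only [Pi.add_apply]; grind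
  · rintro ⟨y, f, g, hf, hg, hc⟩
    obtain ⟨a, ha⟩ := exists_crd lab (A := {x, y}) (x := x) (by simp) f
    obtain ⟨b, hb⟩ := exists_crd lab (A := {y, z}) (x := y) (by simp) g
    obtain ⟨c, hc'⟩ := exists_crd lab (A := {x, z}) (x := x) (by simp) h
    refine Set.subset_sUnion_of_mem ⟨x, y, z, pentagonPair_rel x y, pentagonPair_rel y z,
      (a : Z ⧸ sub lab x y), (b : Z ⧸ sub lab y z), (c : Z ⧸ sub lab x z), ?_, ?_,
      (cosetH_subset_iff x y z a b c).2 ?_, ?_⟩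
    · exact ((atom_eq_atomRel _ a).trans (atomRel_congr ha)).subset.trans hf
    · exact ((atom_eq_atomRel _ b).trans (atomRel_congr hb)).subset.trans hg
    · have h1 : ConstOff {x, y, z} (crd lab x a + f) := ha.mono fun i => by simp; tauto
      have h2 : ConstOff {x, y, z} (crd lab y b + g) := hb.mono fun i => by simp; tauto
      have h3 : ConstOff {x, y, z} (crd lab x c + h) := hc'.mono fun i => by simp; tauto
      refine (h1.add h2).of_add (h3.add hc) ?_
      funext i; simp only [Pi.add_apply]; grind
    · exact ((atom_eq_atomRel _ c).trans (atomRel_congr hc')).symm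

end relations

/-! ### The relation algebra axioms -/

variable (lab)

/-- The full coset relation algebra of the example. -/
abbrev pentagonAlgebra : RelAlg.{0} := (pentagonTriple lab).cosetAlgebra (preFrame_pentagonIso lab)

variable {lab}

theorem pentagon_ext {r s : (pentagonAlgebra lab).carrier}
    (h : ∀ x y f, atomRel lab x y f ⊆ r.1 ↔ atomRel lab x y f ⊆ s.1) : r = s :=
  Subtype.ext (ext_atomRel r.2 s.2 h)

theorem subset_add_iff {r s : (pentagonAlgebra lab).carrier} {x y : Fin 5}
    {f : Fin 5 → ZMod 2} : atomRel lab x y f ⊆ ((pentagonAlgebra lab).add r s).1 ↔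
      atomRel lab x y f ⊆ r.1 ∨ atomRel lab x y f ⊆ s.1 :=
  atomRel_subset_union r.2 s.2

theorem subset_conv_iff {r : (pentagonAlgebra lab).carrier} {x y : Fin 5}
    {f : Fin 5 → ZMod 2} : atomRel lab x y f ⊆ ((pentagonAlgebra lab).conv r).1 ↔
      atomRel lab y x f ⊆ r.1 := atomRel_subset_inv

theorem subset_ident_iff {x y : Fin 5} {f : Fin 5 → ZMod 2} :
    atomRel lab x y f ⊆ (pentagonAlgebra lab).ident.1 ↔ x = y ∧ ConstOff {x, y} f :=
  atomRel_subset_id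

theorem subset_comp_iff {r s : (pentagonAlgebra lab).carrier} {x z : Fin 5}
    {h : Fin 5 → ZMod 2} : atomRel lab x z h ⊆ ((pentagonAlgebra lab).comp r s).1 ↔
      ∃ y f g, atomRel lab x y f ⊆ r.1 ∧ atomRel lab y z g ⊆ s.1 ∧
        ConstOff {x, y, z} (f + g + h + twist {x, y, z}) := atomRel_subset_otimes

theorem one_val : (pentagonAlgebra lab).one.1 = Set.univ := by
  refine (Set.union_sdiff_self (s := SetRel.id) (t := (pentagonTriple lab).unit)).trans ?_
  exact Set.eq_univ_of_forall fun p => Or.inr trivial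

theorem zero_val : (pentagonAlgebra lab).zero.1 = ∅ := by
  change _ \ (pentagonAlgebra lab).one.1 = ∅
  rw [one_val]
  exact Set.sdiff_univ _

theorem unit_eq_univ : (pentagonTriple lab).unit = Set.univ :=
  Set.eq_univ_of_forall fun _ => trivial

theorem neg_val (r : (pentagonAlgebra lab).carrier) :
    ((pentagonAlgebra lab).neg r).1 = (r.1 : Set _)ᶜ := by
  change (pentagonTriple lab).unit \ r.1 = _
  rw [unit_eq_univ, Set.compl_eq_univ_sdiff]

theorem inf_val (r s : (pentagonAlgebra lab).carrier) :
    ((pentagonAlgebra lab).inf r s).1 = r.1 ∩ s.1 := by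
  rw [RelAlg.inf, neg_val]
  change (((pentagonAlgebra lab).neg r).1 ∪ ((pentagonAlgebra lab).neg s).1)ᶜ = _
  rw [neg_val, neg_val, Set.compl_union, compl_compl, compl_compl]

theorem inf_eq_zero_iff (r s : (pentagonAlgebra lab).carrier) :
    (pentagonAlgebra lab).inf r s = (pentagonAlgebra lab).zero ↔
      ∀ x y f, ¬ (atomRel lab x y f ⊆ r.1 ∧ atomRel lab x y f ⊆ s.1) := by
  refine Subtype.ext_iff.trans ?_
  rw [inf_val, zero_val]
  constructor
  · rintro h x y f ⟨h1, h2⟩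
    obtain ⟨a, b, hab⟩ := exists_mem_atomRel lab x y f
    exact (Set.ext_iff.1 h _).1 ⟨h1 hab, h2 hab⟩
  · intro h
    refine Set.eq_empty_of_forall_notMem ?_
    rintro ⟨⟨x, a⟩, ⟨y, b⟩⟩ ⟨h1, h2⟩
    exact h _ _ _ ⟨(mk_mem_iff r.2).1 h1, (mk_mem_iff s.2).1 h2⟩

/-- The diagonal atom l from y to w is eliminated: adding the two triangle conditions cancels l, and
conversely gluing over {y, z, w} and {x, y, w} recovers it. The other bracketing differs only in its
twists. -/
theorem comp_assoc_aux {r s t : (pentagonAlgebra lab).carrier} {x w : Fin 5}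
    {h : Fin 5 → ZMod 2} :
    atomRel lab x w h ⊆
        ((pentagonAlgebra lab).comp r ((pentagonAlgebra lab).comp s t)).1 ↔
      ∃ y z f g k, atomRel lab x y f ⊆ r.1 ∧ atomRel lab y z g ⊆ s.1 ∧
        atomRel lab z w k ⊆ t.1 ∧ ConstOff {x, y, z, w}
          (f + g + k + h + twist {y, z, w} + twist {x, y, w}) := by
  simp only [subset_comp_iff]
  constructor
  · rintro ⟨y, f, l, hf, ⟨z, g, k, hg, hk, h1⟩, h2⟩
    refine ⟨y, z, f, g, k, hf, hg, hk, (h1.mono fun i => by simp; tauto).of_add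
      (h2.mono fun i => by simp; tauto) ?_⟩
    funext i; simp only [Pi.add_apply]; grind
  · rintro ⟨y, z, f, g, k, hf, hg, hk, hc⟩
    have hu : ({y, z, w} ∪ {x, y, w} : Finset (Fin 5)) = {x, y, z, w} := by ext; simp
    have hc' : ConstOff ({y, z, w} ∪ {x, y, w})
        ((g + k + twist {y, z, w}) + (f + h + twist {x, y, w})) := by
      rw [hu]; convert hc using 1; abel
    obtain ⟨l, hl, hl'⟩ := hc'.glue
    refine ⟨y, f, l, hf, ⟨z, g, k, hg, hk, ?_⟩, ?_⟩
    · convert hl using 1; abel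
    · convert hl' using 1; abel

theorem assoc_comp_aux {r s t : (pentagonAlgebra lab).carrier} {x w : Fin 5}
    {h : Fin 5 → ZMod 2} :
    atomRel lab x w h ⊆
        ((pentagonAlgebra lab).comp ((pentagonAlgebra lab).comp r s) t).1 ↔
      ∃ y z f g k, atomRel lab x y f ⊆ r.1 ∧ atomRel lab y z g ⊆ s.1 ∧
        atomRel lab z w k ⊆ t.1 ∧ ConstOff {x, y, z, w}
          (f + g + k + h + twist {x, y, z} + twist {x, z, w}) := by
  simp only [subset_comp_iff]
  constructor
  · rintro ⟨z, l, k, ⟨y, f, g, hf, hg, h1⟩, hk, h2⟩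
    refine ⟨y, z, f, g, k, hf, hg, hk, (h1.mono fun i => by simp; tauto).of_add
      (h2.mono fun i => by simp; tauto) ?_⟩
    funext i; simp only [Pi.add_apply]; grind
  · rintro ⟨y, z, f, g, k, hf, hg, hk, hc⟩
    have hu : ({x, y, z} ∪ {x, z, w} : Finset (Fin 5)) = {x, y, z, w} := by ext; simp
    have hc' : ConstOff ({x, y, z} ∪ {x, z, w})
        ((f + g + twist {x, y, z}) + (k + h + twist {x, z, w})) := by
      rw [hu]; convert hc using 1; abel
    obtain ⟨l, hl, hl'⟩ := hc'.glue
    refine ⟨z, l, k, ⟨y, f, g, hf, hg, ?_⟩, hk, ?_⟩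
    · convert hl using 1; abel
    · convert hl' using 1; abel

theorem isRelationAlgebra_pentagonAlgebra : (pentagonAlgebra lab).IsRelationAlgebra where
  add_comm r s := Subtype.ext (Set.union_comm _ _)
  add_assoc r s t := Subtype.ext (Set.union_assoc _ _ _).symm
  huntington r s := by
    refine Subtype.ext ?_
    change ((pentagonAlgebra lab).neg _).1 ∪ ((pentagonAlgebra lab).neg _).1 = _
    rw [neg_val, neg_val]
    change (((pentagonAlgebra lab).neg r).1 ∪ s.1)ᶜ ∪
      (((pentagonAlgebra lab).neg r).1 ∪ ((pentagonAlgebra lab).neg s).1)ᶜ = _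
    rw [neg_val, neg_val]
    ext p
    simp only [Set.mem_union, Set.mem_compl_iff]
    tauto
  comp_assoc r s t := by
    refine pentagon_ext fun x w h => ?_
    rw [comp_assoc_aux, assoc_comp_aux]
    refine exists_congr fun y => exists_congr fun z => exists_congr fun f => exists_congr fun g =>
      exists_congr fun k => and_congr_right fun _ => and_congr_right fun _ =>
      and_congr_right fun _ => ?_
    -- The two bracketings differ by the sum of the four twists of the tetrahedron, which is
    -- constant off its vertices.
    constructor <;> intro h' <;> refine h'.of_add (twist_assoc x y z w) ?_ <;> funext i <;>
      simp only [Pi.add_apply] <;> grind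
  comp_ident r := by
    refine pentagon_ext fun x y h => ?_
    simp only [subset_comp_iff, subset_ident_iff]
    have htw : ∀ x y : Fin 5, twist {x, y, y} = 0 := by decide
    constructor
    · rintro ⟨z, f, g, hf, ⟨rfl, hg⟩, hc⟩
      rw [htw] at hc
      rwa [← atomRel_congr (f := f)]
      refine ConstOff.of_add (hg.mono (B := {x, z}) fun i => by simp; tauto)
        (hc.mono fun i => by simp) ?_
      funext i; simp only [Pi.add_apply, Pi.zero_apply]; grind
    · intro hf
      refine ⟨y, h, 0, hf, ⟨rfl, ConstOff.zero⟩, ?_⟩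
      rw [htw]
      convert ConstOff.add_self (f := h) using 1
      abel
  conv_conv r := rfl
  conv_comp r s := by
    refine pentagon_ext fun x y h => ?_
    simp only [subset_comp_iff, subset_conv_iff]
    refine exists_congr fun z => ?_
    have hs : ({y, z, x} : Finset (Fin 5)) = {x, z, y} := by ext; simp; tauto
    constructor <;> rintro ⟨f, g, hf, hg, hc⟩ <;> refine ⟨g, f, hg, hf, ?_⟩
    · rwa [← hs, add_comm g]
    · rwa [hs, add_comm g]
  add_comp r s t := by
    refine pentagon_ext fun x y h => ?_
    simp only [subset_comp_iff, subset_add_iff]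
    constructor
    · rintro ⟨z, f, g, hf | hf, hg⟩
      · exact Or.inl ⟨z, f, g, hf, hg⟩
      · exact Or.inr ⟨z, f, g, hf, hg⟩
    · rintro (⟨z, f, g, hf, hg⟩ | ⟨z, f, g, hf, hg⟩)
      · exact ⟨z, f, g, Or.inl hf, hg⟩
      · exact ⟨z, f, g, Or.inr hf, hg⟩
  conv_add r s := rfl
  cycle r s t h := by
    rw [inf_eq_zero_iff] at h ⊢
    rintro x y g ⟨h1, hg⟩
    obtain ⟨z, f, k, hf, hk, hc⟩ := subset_comp_iff.1 h1
    rw [subset_conv_iff] at hf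
    -- The same triangle is read from another vertex; its condition does not change.
    refine h z y k ⟨subset_comp_iff.2 ⟨x, f, g, hf, hg, ?_⟩, hk⟩
    have hs : ({z, x, y} : Finset (Fin 5)) = {x, z, y} := by ext; simp; tauto
    rw [hs]
    convert hc using 1
    abel

/-! ### Measurability -/

theorem le_iff {r s : (pentagonAlgebra lab).carrier} :
    (pentagonAlgebra lab).le r s ↔ r.1 ⊆ s.1 :=
  Subtype.ext_iff.trans Set.union_eq_right

variable (lab) in
/-- The atom `R_{xy,α}` as an element of the algebra. -/
def atomElt (x y : Fin 5) (f : Fin 5 → ZMod 2) : (pentagonAlgebra lab).carrier :=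
  ⟨atomRel lab x y f, atomRel_mem_relations x y f⟩

theorem atomRel_subset_atomRel {x y x' y' : Fin 5} {f g : Fin 5 → ZMod 2} :
    atomRel lab x y f ⊆ atomRel lab x' y' g ↔ x = x' ∧ y = y' ∧ ConstOff {x, y} (f + g) := by
  constructor
  · intro h
    obtain ⟨a, b, hab⟩ := exists_mem_atomRel lab x y f
    obtain ⟨h1, h2, h3⟩ := h hab
    dsimp only at h1 h2
    subst h1 h2
    refine ⟨rfl, rfl, hab.2.2.of_add h3 ?_⟩
    funext i; simp only [Pi.add_apply]; grind
  · rintro ⟨rfl, rfl, h⟩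
    rw [atomRel_congr h]

theorem isAtomElt_atomElt (x y : Fin 5) (f : Fin 5 → ZMod 2) :
    (pentagonAlgebra lab).IsAtomElt (atomElt lab x y f) := by
  constructor
  · intro h
    obtain ⟨a, b, hab⟩ := exists_mem_atomRel lab x y f
    have h' : atomRel lab x y f = ∅ := (Subtype.ext_iff.1 h).trans zero_val
    exact Set.notMem_empty _ (h' ▸ hab)
  · intro b hb
    rw [le_iff] at hb
    by_cases hne : (b.1 : Set _).Nonempty
    · right
      obtain ⟨p, hp⟩ := hne
      exact Subtype.ext (hb.antisymm (atomRel_subset_of_mem b.2 (hb hp) hp))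
    · left
      exact Subtype.ext ((Set.not_nonempty_iff_eq_empty.1 hne).trans zero_val.symm)

/-- Since H_xx is trivial and the degenerate triangle is untwisted, R_xx,f behaves like a
translation of G_x. These atoms exhaust the square on x, which gives measurability. -/
theorem isFunctional_atomElt (x : Fin 5) (f : Fin 5 → ZMod 2) :
    (pentagonAlgebra lab).IsFunctional (atomElt lab x x f) := by
  rw [RelAlg.IsFunctional, le_iff]
  refine subset_of_atomRel (Subtype.property _) fun y z h hs => ?_
  obtain ⟨w, k, l, hk, hl, hc⟩ := subset_comp_iff.1 hs
  rw [subset_conv_iff] at hk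
  obtain ⟨rfl, rfl, hk⟩ := atomRel_subset_atomRel.1 hk
  obtain ⟨-, rfl, hl⟩ := atomRel_subset_atomRel.1 hl
  refine subset_ident_iff.2 ⟨rfl, ?_⟩
  have htw : ∀ x : Fin 5, twist {x, x, x} = 0 := by decide
  rw [htw] at hc
  refine (hk.add hl).of_add (hc.mono fun i => by simp) ?_
  funext i; simp only [Pi.add_apply, Pi.zero_apply]; grind

theorem of_subset_square {x y z : Fin 5} {f : Fin 5 → ZMod 2} :
    atomRel lab y z f ⊆ ((pentagonAlgebra lab).comp ((pentagonAlgebra lab).comp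
      (atomElt lab x x 0) (pentagonAlgebra lab).one) (atomElt lab x x 0)).1 → y = x ∧ z = x := by
  intro h
  obtain ⟨w, k, l, hk, hl, -⟩ := subset_comp_iff.1 h
  obtain ⟨w', k', l', hk', -, -⟩ := subset_comp_iff.1 hk
  exact ⟨(atomRel_subset_atomRel.1 hk').1, (atomRel_subset_atomRel.1 hl).2.1⟩

theorem isMeasurableElt_atomElt (x : Fin 5) :
    (pentagonAlgebra lab).IsMeasurableElt (atomElt lab x x 0) := by
  refine ⟨le_iff.2 (subset_ident_iff.2 ⟨rfl, ConstOff.zero⟩), isAtomElt_atomElt x x 0,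
    {f | (pentagonAlgebra lab).IsFunctional f ∧ (pentagonAlgebra lab).le f
      ((pentagonAlgebra lab).comp ((pentagonAlgebra lab).comp
      (atomElt lab x x 0) (pentagonAlgebra lab).one) (atomElt lab x x 0))}, fun f hf => hf.1,
    fun f hf => hf.2, fun b hb => le_iff.2 (subset_of_atomRel (Subtype.property _) ?_)⟩
  intro y z f hf
  obtain ⟨rfl, rfl⟩ := of_subset_square hf
  exact le_iff.1 (hb (atomElt lab _ _ f) ⟨isFunctional_atomElt _ f, le_iff.2 hf⟩)

theorem isMeasurable_pentagonAlgebra : (pentagonAlgebra lab).IsMeasurable := by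
  refine ⟨Set.range fun x => atomElt lab x x 0, ?_, ?_, fun b hb => le_iff.2
    (subset_of_atomRel (Subtype.property _) ?_)⟩
  · rintro _ ⟨x, rfl⟩
    exact isMeasurableElt_atomElt x
  · rintro _ ⟨x, rfl⟩
    exact le_iff.2 (subset_ident_iff.2 ⟨rfl, ConstOff.zero⟩)
  · intro x y f hf
    obtain ⟨rfl, hf⟩ := subset_ident_iff.1 hf
    rw [atomRel_congr (f := f) (g := 0) (by simpa using hf)]
    exact le_iff.1 (hb _ ⟨x, rfl⟩)

theorem finite_pentagonAlgebra : Finite (pentagonAlgebra lab).carrier :=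
  inferInstanceAs (Finite {X : Set ((Σ _ : Fin 5, Z) × (Σ _ : Fin 5, Z)) //
    X ∈ (pentagonTriple lab).relations})

/-! ### Non-representability -/

/-- The sum over all triangles of the coboundary of an edge labelling vanishes, whereas exactly
one triangle is twisted. -/
theorem not_forall_constOff_twist (f : Fin 5 → Fin 5 → Fin 5 → ZMod 2) :
    ¬ ∀ x y z, ConstOff {x, y, z} (f x y + f y z + f x z + twist {x, y, z}) := by
  intro h
  have key : ∀ x y z s t : Fin 5, s ∉ ({x, y, z} : Finset (Fin 5)) →
      t ∉ ({x, y, z} : Finset (Fin 5)) →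
      f x y s + f y z s + f x z s + twist {x, y, z} s =
        f x y t + f y z t + f x z t + twist {x, y, z} t := by
    intro x y z s t hs ht
    obtain ⟨k, hk⟩ := h x y z
    exact (hk s hs).trans (hk t ht).symm
  -- The ten triangles, each with its complementary pair of vertices as evaluation points.
  have h1 := key 0 1 2 3 4 (by decide) (by decide)
  have h2 := key 0 1 3 2 4 (by decide) (by decide)
  have h3 := key 0 1 4 2 3 (by decide) (by decide)
  have h4 := key 0 2 3 1 4 (by decide) (by decide)
  have h5 := key 0 2 4 1 3 (by decide) (by decide)
  have h6 := key 0 3 4 1 2 (by decide) (by decide)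
  have h7 := key 1 2 3 0 4 (by decide) (by decide)
  have h8 := key 1 2 4 0 3 (by decide) (by decide)
  have h9 := key 1 3 4 0 2 (by decide) (by decide)
  have h10 := key 2 3 4 0 1 (by decide) (by decide)
  have t1 : twist {0, 1, 2} = Pi.single 3 1 := by decide
  have t2 : twist {0, 1, 3} = 0 := by decide
  have t3 : twist {0, 1, 4} = 0 := by decide
  have t4 : twist {0, 2, 3} = 0 := by decide
  have t5 : twist {0, 2, 4} = 0 := by decide
  have t6 : twist {0, 3, 4} = 0 := by decide
  have t7 : twist {1, 2, 3} = 0 := by decide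
  have t8 : twist {1, 2, 4} = 0 := by decide
  have t9 : twist {1, 3, 4} = 0 := by decide
  have t10 : twist {2, 3, 4} = 0 := by decide
  simp only [t1, t2, t3, t4, t5, t6, t7, t8, t9, t10, Pi.zero_apply, Pi.single_eq_same,
    Pi.single_eq_of_ne (show (4 : Fin 5) ≠ 3 by decide), add_zero] at h1 h2 h3 h4 h5 h6 h7 h8 h9 h10
  -- In the sum of the ten equations every value of f occurs twice; only the twist of {0, 1, 2},
  -- which is 1 at 3 and 0 at 4, survives.
  grind

/-! ### From a representation to an edge labelling -/

section Representation

variable {U : Type w} {E : Setoid U}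
  {φ : (pentagonAlgebra lab).carrier → (RelAlg.fullSet E).carrier}

theorem hom_mono (hφ : RelAlg.IsHom φ) {r s : (pentagonAlgebra lab).carrier}
    (h : r.1 ⊆ s.1) : (φ r).1 ⊆ (φ s).1 := by
  have h1 : (pentagonAlgebra lab).add r s = s := le_iff.2 h
  have h2 : (φ r).1 ∪ (φ s).1 = (φ s).1 := by
    conv_rhs => rw [← h1, hφ.map_add]
    rfl
  exact Set.union_eq_right.1 h2

theorem hom_zero (hφ : RelAlg.IsHom φ) : (φ (pentagonAlgebra lab).zero).1 = ∅ := by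
  have h : φ (pentagonAlgebra lab).zero = (RelAlg.fullSet E).zero := by
    rw [RelAlg.zero, RelAlg.zero, RelAlg.one, RelAlg.one, hφ.map_neg, hφ.map_add, hφ.map_neg,
      hφ.map_ident]
  rw [h]
  refine Set.eq_empty_of_forall_notMem fun p hp => hp.2 ?_
  by_cases h' : p ∈ (RelAlg.fullSet E).ident.1
  · exact Or.inl h'
  · exact Or.inr ⟨hp.1, h'⟩

theorem hom_comp (hφ : RelAlg.IsHom φ) {r s : (pentagonAlgebra lab).carrier} {a b c : U}
    (h1 : (a, b) ∈ (φ r).1) (h2 : (b, c) ∈ (φ s).1) :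
    (a, c) ∈ (φ ((pentagonAlgebra lab).comp r s)).1 := by
  rw [hφ.map_comp]
  exact ⟨b, h1, h2⟩

/-- Elements whose images share a pair intersect. -/
theorem exists_atomRel_of_mem (hφ : RelAlg.IsHom φ) {r s : (pentagonAlgebra lab).carrier}
    {p : U × U} (h1 : p ∈ (φ r).1) (h2 : p ∈ (φ s).1) :
    ∃ x y f, atomRel lab x y f ⊆ r.1 ∧ atomRel lab x y f ⊆ s.1 := by
  by_contra! hne
  have h0 := (inf_eq_zero_iff r s).2 fun x y f h => hne x y f h.1 h.2
  have hp : p ∈ (φ ((pentagonAlgebra lab).inf r s)).1 := by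
    rw [RelAlg.inf, hφ.map_neg, hφ.map_add, hφ.map_neg, hφ.map_neg]
    exact ⟨(φ r).2 p h1, fun h => h.elim (fun h => h.2 h1) fun h => h.2 h2⟩
  rw [h0, hom_zero hφ] at hp
  exact hp

/-- A finite union of atoms is mapped to the union of their images. -/
theorem exists_mem_hom_atomElt (hφ : RelAlg.IsHom φ) {r : (pentagonAlgebra lab).carrier}
    {p : U × U} (hp : p ∈ (φ r).1) :
    ∃ x y f, atomRel lab x y f ⊆ r.1 ∧ p ∈ (φ (atomElt lab x y f)).1 := by
  have := finite_pentagonAlgebra (lab := lab)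
  by_contra! hne
  -- A homomorphism need not preserve infinite sums, so finiteness enters here. If no atom below r
  -- had p in its image, then removing an atom from a minimal s would contradict minimality.
  obtain ⟨s, ⟨hs, hps⟩, hmin⟩ := Set.Finite.exists_minimalFor
    (fun s : (pentagonAlgebra lab).carrier => (s.1 : Set _))
    {s | s.1 ⊆ r.1 ∧ p ∈ (φ s).1} (Set.toFinite _) ⟨r, subset_rfl, hp⟩
  obtain ⟨x, y, f, hf, -⟩ := exists_atomRel_of_mem hφ hps hps
  have hcover : p ∈ (φ ((pentagonAlgebra lab).neg (atomElt lab x y f))).1 := by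
    rw [hφ.map_neg]
    exact ⟨(φ s).2 p hps, hne x y f (hf.trans hs)⟩
  have hinf : p ∈ (φ ((pentagonAlgebra lab).inf s
      ((pentagonAlgebra lab).neg (atomElt lab x y f)))).1 := by
    rw [RelAlg.inf, hφ.map_neg, hφ.map_add, hφ.map_neg, hφ.map_neg]
    exact ⟨(φ s).2 p hps, fun h => h.elim (fun h => h.2 hps) fun h => h.2 hcover⟩
  have hsub : ((pentagonAlgebra lab).inf s
      ((pentagonAlgebra lab).neg (atomElt lab x y f))).1 ⊆ s.1 := by
    rw [inf_val]; exact Set.inter_subset_left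
  have hle := hmin ⟨hsub.trans hs, hinf⟩ hsub
  obtain ⟨a, b, hab⟩ := exists_mem_atomRel lab x y f
  have := hle (hf hab)
  simp only [inf_val, neg_val] at this
  exact this.2 hab

variable (lab) in
/-- The rectangle `G_x × G_y`. -/
def rect (x y : Fin 5) : (pentagonAlgebra lab).carrier :=
  ⟨{p | p.1.1 = x ∧ p.2.1 = y}, by
    refine GroupPair.mem_relations_iff.2 ⟨fun _ _ => trivial, ?_⟩
    rintro R ⟨x', y', h, α, rfl⟩ p hp ⟨h1, h2⟩ q hq
    obtain ⟨a, b, rfl, -⟩ := hp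
    obtain ⟨c, d, rfl, -⟩ := hq
    exact ⟨h1, h2⟩⟩

theorem subset_rect_iff {x y x' y' : Fin 5} {f : Fin 5 → ZMod 2} :
    atomRel lab x y f ⊆ (rect lab x' y').1 ↔ x = x' ∧ y = y' := by
  constructor
  · intro h
    obtain ⟨a, b, hab⟩ := exists_mem_atomRel lab x y f
    exact h hab
  · rintro ⟨rfl, rfl⟩ p hp
    exact ⟨hp.1, hp.2.1⟩

/-- Injectivity serves only to provide one pair in the image of a nonzero element. From it grow five
points, one for each index, whose connecting atoms form the impossible edge labelling. -/
theorem not_isHom_injective (hφ : RelAlg.IsHom φ) (hinj : Function.Injective φ) : False := by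
  have hne : (φ (atomElt lab 0 0 0)).1 ≠ ∅ := by
    intro h
    exact (isAtomElt_atomElt 0 0 0).1 (hinj (Subtype.ext (h.trans (hom_zero hφ).symm)))
  obtain ⟨⟨u, u'⟩, hu⟩ := Set.nonempty_iff_ne_empty.2 hne
  have hpts : ∀ x, ∃ c, (u, c) ∈ (φ (rect lab 0 x)).1 ∧ (c, u') ∈ (φ (rect lab x 0)).1 := by
    intro x
    have h : atomRel lab 0 0 0 ⊆ ((pentagonAlgebra lab).comp (rect lab 0 x) (rect lab x 0)).1 :=
      -- Rectangles contain every atom between their endpoints, so the second label may be chosen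
      -- equal to the twist in order to cancel it.
      subset_comp_iff.2 ⟨x, 0, twist {0, x, 0}, subset_rect_iff.2 ⟨rfl, rfl⟩,
        subset_rect_iff.2 ⟨rfl, rfl⟩, by simpa using ConstOff.add_self⟩
    have h' := hom_mono hφ (r := atomElt lab 0 0 0) h hu
    rw [hφ.map_comp] at h'
    exact h'
  choose c hc hc' using hpts
  have hinv : ∀ x, (c x, u) ∈ (φ (rect lab x 0)).1 := by
    intro x
    have h : (pentagonAlgebra lab).conv (rect lab 0 x) = rect lab x 0 :=
      Subtype.ext (Set.ext fun p => and_comm)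
    rw [← h, hφ.map_conv]
    exact hc x
  have hedge : ∀ x y, ∃ f, (c x, c y) ∈ (φ (atomElt lab x y f)).1 := by
    intro x y
    -- The path from c x through u to c y places the pair in the image of a product of rectangles,
    -- all of whose atoms run from x to y.
    obtain ⟨x', y', f, hf, hm⟩ := exists_mem_hom_atomElt hφ (hom_comp hφ (hinv x) (hc y))
    obtain ⟨z, k, l, hk, hl, -⟩ := subset_comp_iff.1 hf
    obtain ⟨rfl, -⟩ := subset_rect_iff.1 hk
    obtain ⟨-, rfl⟩ := subset_rect_iff.1 hl
    exact ⟨f, hm⟩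
  choose f hf using hedge
  refine not_forall_constOff_twist f fun x y z => ?_
  -- The pair (c x, c z) lies in the image of the product of two edge atoms and in that of the
  -- third, so these elements share an atom and the product rule applies.
  obtain ⟨x', z', h, h1, h2⟩ := exists_atomRel_of_mem hφ
    (hom_comp hφ (hf x y) (hf y z)) (hf x z)
  obtain ⟨rfl, rfl, h2⟩ := atomRel_subset_atomRel.1 h2
  obtain ⟨y', k, l, hk, hl, hcst⟩ := subset_comp_iff.1 h1
  obtain ⟨-, rfl, hk⟩ := atomRel_subset_atomRel.1 hk
  obtain ⟨-, -, hl⟩ := atomRel_subset_atomRel.1 hl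
  have e1 := hk.mono (B := {x', y', z'}) fun i => by simp; tauto
  have e2 := hl.mono (B := {x', y', z'}) fun i => by simp; tauto
  have e3 := h2.mono (B := {x', y', z'}) fun i => by simp; tauto
  refine (e1.add e2).of_add (e3.add hcst) ?_
  funext i; simp only [Pi.add_apply]; grind

end Representation

theorem not_representable_pentagonAlgebra :
    ¬ RelAlg.Representable.{0, w} (pentagonAlgebra lab) := by
  rintro ⟨U, E, φ, hφ, hinj⟩
  exact not_isHom_injective hφ hinj

/-! ### Full group relation algebras are set relation algebras -/

/-- The operations are already the set-theoretic ones, and the unit is the index equivalence pulled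
back to the disjoint union of the groups, so inclusion is an embedding. -/
theorem GroupPair.embeddable_groupAlgebra {I : Type u} {G : I → Type v} [∀ x, Group (G x)]
    (F : GroupPair G) (h : F.IsGroupFrame) :
    (F.groupAlgebra h).Embeddable (RelAlg.fullSet (F.E.comap (Sigma.fst : (Σ x, G x) → I))) := by
  refine ⟨fun X => ⟨X.1, fun p hp => (GroupPair.mem_relations_iff.1 X.2).1 hp⟩,
    ⟨fun _ _ => rfl, fun _ => rfl, fun _ _ => rfl, fun _ => rfl, rfl⟩, fun X Y hXY => ?_⟩
  exact Subtype.ext (Subtype.mk.inj hXY)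

theorem RelAlg.Embeddable.trans {A : RelAlg.{u}} {B : RelAlg.{v}} {C : RelAlg.{w}}
    (h : A.Embeddable B) (h' : B.Embeddable C) : A.Embeddable C := by
  obtain ⟨f, hf, hfi⟩ := h
  obtain ⟨g, hg, hgi⟩ := h'
  refine ⟨g ∘ f, ⟨?_, ?_, ?_, ?_, ?_⟩, hgi.comp hfi⟩
  · intro a b; simp [hf.map_add, hg.map_add]
  · intro a; simp [hf.map_neg, hg.map_neg]
  · intro a b; simp [hf.map_comp, hg.map_comp]
  · intro a; simp [hf.map_conv, hg.map_conv]
  · simp [hf.map_ident, hg.map_ident]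

theorem not_embeddable_groupAlgebra {I : Type u} {G : I → Type v} [∀ x, Group (G x)]
    (F : GroupPair G) (h : F.IsGroupFrame) :
    ¬ (pentagonAlgebra lab).Embeddable (F.groupAlgebra h) := fun hE =>
  not_representable_pentagonAlgebra ⟨_, _, hE.trans (F.embeddable_groupAlgebra h)⟩

end CosetRA

theorem mainTheorem3 (lab : CosetRA.Labelling) :
    (∀ ψ, (CosetRA.pentagonPair lab ψ).IsGroupFrame ↔ ψ = CosetRA.pentagonIso lab) ∧
    ∃ hF : (CosetRA.pentagonTriple lab).IsSemiFrame,
      (CosetRA.pentagonTriple lab).CosetConditions ∧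
      ((CosetRA.pentagonTriple lab).cosetAlgebra hF.toPreFrame).IsRelationAlgebra ∧
      Finite ((CosetRA.pentagonTriple lab).cosetAlgebra hF.toPreFrame).carrier ∧
      ((CosetRA.pentagonTriple lab).cosetAlgebra hF.toPreFrame).IsMeasurable ∧
      ¬ CosetRA.RelAlg.Representable.{0, w}
        ((CosetRA.pentagonTriple lab).cosetAlgebra hF.toPreFrame) ∧
      ∀ {I : Type u} {G : I → Type v} [∀ x, Group (G x)] (F : CosetRA.GroupPair G)
        (h : F.IsGroupFrame),
        ¬ ((CosetRA.pentagonTriple lab).cosetAlgebra hF.toPreFrame).Isomorphic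
            (F.groupAlgebra h) ∧
        ¬ ((CosetRA.pentagonTriple lab).cosetAlgebra hF.toPreFrame).Embeddable
            (F.groupAlgebra h) :=
  ⟨CosetRA.isGroupFrame_iff, CosetRA.isSemiFrame_pentagonTriple lab,
    CosetRA.cosetConditions_pentagonTriple lab, CosetRA.isRelationAlgebra_pentagonAlgebra,
    CosetRA.finite_pentagonAlgebra, CosetRA.isMeasurable_pentagonAlgebra,
    CosetRA.not_representable_pentagonAlgebra, fun F h =>
    ⟨fun ⟨f, hf, hb⟩ => CosetRA.not_embeddable_groupAlgebra F h ⟨f, hf, hb.1⟩,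
      CosetRA.not_embeddable_groupAlgebra F h⟩⟩
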